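/- Let $n\ge 1$, let $A\in\mathbb C^{n\times n}$ be skew-Hermitian ($A^*=-A$) with eigenvalues $i\lambda_1,\dots,i\lambda_n$, $\lambda_1\le\dots\le\lambda_n$, counted with multiplicity, and let $v_1,\dots,v_n$ be an orthonormal basis of $\mathbb C^n$ with $Av_j=i\lambda_jv_j$. Let $B\in\mathbb C^{n\times m}$, and let $X$ be a positive semidefinite solution of the algebraic Riccati equation $XBB^*X-XA-A^*X-I=0$. The eigenvalues, counted with algebraic multiplicity, of the closed-loop matrix $A-BB^*X$ (the linear quadratic optimal feedback for the weights $Q=I$, $R=I$) are called the closed-loop eigenvalues. Let $\|\cdot\|$ be the Euclidean norm of vectors and the induced norm of matrices, and put $b_k=B^*v_k$, $\Delta=\lambda_n-\lambda_1$ and, for $n\ge2$, $\delta_k=\min_{j\ne k}|\lambda_j-\lambda_k|$, $$\rho_k=\frac{\|b_k\|}{1+2\|B\|^2/\delta_k^2},\qquad \rho_k^1=\frac{\|b_k\|}{\sqrt{1+2\|B\|^2/\delta_k^2}}\qquad(\rho_k=\rho_k^1=0\text{ if }\delta_k=0).$$ For $1\le k\le n-1$ let $T_k\subset\mathbb C$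 be the closed right triangle with vertices $i\lambda_k$, $i\lambda_{k+1}$ and $-\frac{\lambda_{k+1}-\lambda_k}2+i\,\frac{\lambda_{k+1}+\lambda_k}2$. A box $I\times J$ denotes $\{z\in\mathbb C:\operatorname{Re}z\in I,\ \operatorname{Im}z\in J\}$. 1. All closed-loop eigenvalues lie in the box $[-\|B\|,0)\times[\lambda_1,\lambda_n]$, outside every triangle $T_k$ and, if $n\ge2$, outside the closed disks centred at $i\lambda_k$ of radii $\rho_k$, $1\le k\le n$. 2. If moreover $m\le n$ and the smallest singular value $\sigma_m$ of $B$ satisfies $\sigma_m>2\sqrt2\,\Delta$, then exactly $m$ closed-loop eigenvalues lie in the box $[-\|B\|,-\frac{\sqrt6}4\sigma_m]\times[\lambda_1,\lambda_n]$, and the other $n-m$ lie in the box $(-\sqrt3\,\Delta,0)\times[\lambda_1,\lambda_n]$. 3. If $m=1$ and $n\ge2$, then all closed-loop eigenvalues also lie outside the closed disks centred at $i\lambda_k$ of the larger radii $\rho_k^1$, $1\le k\le n$. -/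

import Mathlib

open scoped Matrix Matrix.Norms.L2Operator ComplexOrder

namespace LQR

/-- `X` is a nonnegative (Hermitian positive semidefinite) solution of the continuous algebraic
Riccati equation `X B Bᴴ X - X A - Aᴴ X - I = 0`, i.e. the one with weights `Q = I`, `R = I`. -/
structure IsRiccatiSolution {n m : ℕ} (A : Matrix (Fin n) (Fin n) ℂ)
    (B : Matrix (Fin n) (Fin m) ℂ) (X : Matrix (Fin n) (Fin n) ℂ) : Prop where
  posSemidef : X.PosSemidef
  care : X * B * Bᴴ * X - X * A - Aᴴ * X - 1 = 0

/-- The closed-loop matrix `A - B F`, where `F = Bᴴ X` is the feedback matrix. -/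
def closedLoop {n m : ℕ} (A : Matrix (Fin n) (Fin n) ℂ)
    (B : Matrix (Fin n) (Fin m) ℂ) (X : Matrix (Fin n) (Fin n) ℂ) : Matrix (Fin n) (Fin n) ℂ :=
  A - B * (Bᴴ * X)

/-- The closed-loop eigenvalues, each repeated according to its algebraic multiplicity. -/
noncomputable def closedLoopEigenvalues {n m : ℕ} (A : Matrix (Fin n) (Fin n) ℂ)
    (B : Matrix (Fin n) (Fin m) ℂ) (X : Matrix (Fin n) (Fin n) ℂ) : Multiset ℂ :=
  (closedLoop A B X).charpoly.roots

open Classical in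
/-- The number of elements of the multiset `s` (with multiplicity) that lie in the set `S`. -/
noncomputable def numIn (s : Multiset ℂ) (S : Set ℂ) : ℕ :=
  (s.filter (fun z => z ∈ S)).card

/-- The vector `b = Bᴴ v`. -/
noncomputable def controlVec {n m : ℕ} (B : Matrix (Fin n) (Fin m) ℂ)
    (v : EuclideanSpace ℂ (Fin n)) : EuclideanSpace ℂ (Fin m) :=
  Matrix.toEuclideanLin Bᴴ v

/-- The smallest singular value `σ_m` of an `n × m` matrix with `m ≤ n`
(Mathlib lists singular values in decreasing order, starting from index `0`). -/
noncomputable def sigmaMin {n m : ℕ} (B : Matrix (Fin n) (Fin m) ℂ) : ℝ :=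
  (Matrix.toEuclideanLin B).singularValues (m - 1)

/-- The separation `δ_k = min_{j ≠ k} |λ_j - λ_k|` (used for `n ≥ 2`). -/
noncomputable def sep {n : ℕ} (lam : Fin n → ℝ) (k : Fin n) : ℝ :=
  ⨅ j : {j : Fin n // j ≠ k}, |lam j - lam k|

/-- The radius `ρ = b / (1 + 2 β² / δ²)`, read as its limiting value `0` when `δ = 0`. -/
noncomputable def radius (b β δ : ℝ) : ℝ :=
  if δ = 0 then 0 else b / (1 + 2 * (β ^ 2 / δ ^ 2))

/-- The radius `ρ¹ = b / √(1 + 2 β² / δ²)`, read as its limiting value `0` when `δ = 0`. -/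
noncomputable def radiusOne (b β δ : ℝ) : ℝ :=
  if δ = 0 then 0 else b / √(1 + 2 * (β ^ 2 / δ ^ 2))

/-- The closed right triangle with vertices `i a`, `i b` and `-(b - a) / 2 + i (a + b) / 2`. -/
noncomputable def triangle (a b : ℝ) : Set ℂ :=
  convexHull ℝ {(⟨0, a⟩ : ℂ), ⟨0, b⟩, ⟨-(b - a) / 2, (b + a) / 2⟩}

end LQR

/-! Write `Y = X⁻¹`, which exists because the Riccati equation excludes a kernel of `X`. The
equation becomes `B Bᴴ = Y² + A Y - Y A`, the closed-loop matrix is similar to `A - Y`, and `(A - ν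
+ Y)(A - ν - Y) = (A - ν)² - B Bᴴ`. Closed-loop eigenvalues therefore solve a quadratic eigenvalue
problem free of `X`; in the basis `v` it reads `(iλ_j - ν)² w_j = ⟪b_j, f⟫` with `f = ∑ w_i b_i`.

Pairing with `w` gives `∑ (iλ_j - ν)² |w_j|² = ‖f‖²`. Its imaginary part makes `Im ν` a weighted
mean of the `λ_j`; its real part forces some `λ_j` within `|Re ν|` of `Im ν`, which excludes the
triangles. Summing squared moduli bounds `|Re ν|`. Near `iλ_k` the component `w_k` dominates
(`component_bounds`), which excludes the disks.

For the two groups, pairing with the component of `w` in the kernel of `Bᴴ` yields a vertical strip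
without eigenvalues (`gap`). The bounds persist while `A` is deformed to a scalar matrix, so the
number of eigenvalues left of the strip is constant (`numIn_closedLoopEigenvalues`); at the scalar
end it is the rank of `B Bᴴ`. -/

namespace LQR

/-! ### Estimates for the quadratic eigenvalue problem. -/

section QuadraticEigenvalue

open scoped InnerProductSpace

variable {ι F : Type*} [Fintype ι] [NormedAddCommGroup F] [InnerProductSpace ℂ F]

/-- `w` is an eigenvector at `ν` of the quadratic eigenvalue problem `(i Λ - ν)² w = G w`, where
`Λ` is the diagonal matrix of `lam` and `G` is the Gram matrix of the family `b`. -/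
structure IsQuadraticEigenvector (lam : ι → ℝ) (b : ι → F) (ν : ℂ) (w : ι → ℂ) : Prop where
  ne_zero : w ≠ 0
  eq : ∀ j, (Complex.I * lam j - ν) ^ 2 * w j = ⟪b j, ∑ i, w i • b i⟫_ℂ

theorem sum_conj_mul_inner (b : ι → F) (u : ι → ℂ) (f : F) :
    ∑ j, (starRingEnd ℂ) (u j) * ⟪b j, f⟫_ℂ = ⟪∑ j, u j • b j, f⟫_ℂ := by
  simp [mul_comm]

theorem norm_sq_I_mul_sub (x : ℝ) (ν : ℂ) :
    ‖Complex.I * x - ν‖ ^ 2 = (x - ν.im) ^ 2 + ν.re ^ 2 := by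
  rw [← Complex.normSq_eq_norm_sq, Complex.normSq_apply]
  simp
  ring

/-- An operator and its adjoint have the same norm: with `u_j = ⟪b_j, f⟫` the sum `S` equals `⟪∑ u_j
b_j, f⟫`, so Cauchy–Schwarz gives `S² ≤ β² ‖f‖² S`. -/
theorem sum_norm_inner_sq_le {b : ι → F} {β : ℝ}
    (hb : ∀ u : ι → ℂ, ‖∑ i, u i • b i‖ ^ 2 ≤ β ^ 2 * ∑ i, ‖u i‖ ^ 2) (f : F) :
    ∑ j, ‖⟪b j, f⟫_ℂ‖ ^ 2 ≤ β ^ 2 * ‖f‖ ^ 2 := by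
  set u : ι → ℂ := fun j => ⟪b j, f⟫_ℂ with hu
  set S := ∑ j, ‖⟪b j, f⟫_ℂ‖ ^ 2 with hS
  have hS0 : 0 ≤ S := Finset.sum_nonneg fun _ _ => by positivity
  have h1 : (S : ℂ) = ⟪∑ j, u j • b j, f⟫_ℂ := by
    rw [← sum_conj_mul_inner, hS]
    push_cast
    refine Finset.sum_congr rfl fun j _ => ?_
    rw [mul_comm, Complex.mul_conj, Complex.normSq_eq_norm_sq]
    push_cast
    rfl
  have h2 : S ≤ ‖∑ j, u j • b j‖ * ‖f‖ := by
    have := norm_inner_le_norm (𝕜 := ℂ) (∑ j, u j • b j) f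
    rwa [← h1, Complex.norm_real, Real.norm_of_nonneg hS0] at this
  have h3 := hb u
  have h4 : S ^ 2 ≤ (β ^ 2 * ‖f‖ ^ 2) * S := by
    calc S ^ 2 ≤ (‖∑ j, u j • b j‖ * ‖f‖) ^ 2 := by gcongr
      _ = ‖∑ j, u j • b j‖ ^ 2 * ‖f‖ ^ 2 := by ring
      _ ≤ (β ^ 2 * S) * ‖f‖ ^ 2 := by gcongr
      _ = _ := by ring
  rcases hS0.eq_or_lt with h | h
  · rw [← h]; positivity
  · nlinarith

theorem norm_sum_conj_mul_le {t : ι → ℝ} {T : ℝ} (hT : 0 ≤ T) (ht : ∀ j, |t j| ≤ T)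
    (q x : ι → ℂ) : ‖∑ j, t j * ((starRingEnd ℂ) (q j) * x j)‖ ≤
      T * (√(∑ j, ‖q j‖ ^ 2) * √(∑ j, ‖x j‖ ^ 2)) := by
  calc ‖∑ j, t j * ((starRingEnd ℂ) (q j) * x j)‖
      ≤ ∑ j, T * (‖q j‖ * ‖x j‖) := by
        refine (norm_sum_le _ _).trans (Finset.sum_le_sum fun j _ => ?_)
        rw [norm_mul, norm_mul, Complex.norm_real, RCLike.norm_conj, Real.norm_eq_abs]
        gcongr
        exact ht j
    _ = T * ∑ j, ‖q j‖ * ‖x j‖ := (Finset.mul_sum _ _ _).symm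
    _ ≤ _ := by
        gcongr
        exact Real.sum_mul_le_sqrt_mul_sqrt _ _ _

/-- Numerical core of `gap`. The decimals round `√(3/8)` up, `√(5/8)` down and `1/√3` up; the
contradiction is `1/3 + 0.578 * 0.613 < 0.79`. -/
theorem gap_arithmetic {σ a Δ P Q W : ℝ} (hσ : 0 < σ) (ha0 : 0 < a) (hW0 : 0 < W)
    (hP0 : 0 ≤ P) (hQ0 : 0 ≤ Q) (hpyth : W ^ 2 = P ^ 2 + Q ^ 2)
    (hp : σ ^ 2 * P ^ 2 ≤ a ^ 2 * W ^ 2) (hlow : 3 * Δ ^ 2 ≤ a ^ 2) (hc : a ^ 2 < 3 / 8 * σ ^ 2)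
    (hkey : a ^ 2 * Q ^ 2 ≤ Δ ^ 2 * (Q * W) + a * Δ * (Q * P)) : False := by
  have hPW : P ^ 2 ≤ 3 / 8 * W ^ 2 := by
    have h1 : σ ^ 2 * P ^ 2 ≤ 3 / 8 * σ ^ 2 * W ^ 2 :=
      hp.trans (by gcongr)
    have : 0 < σ ^ 2 := by positivity
    nlinarith
  have hPle : P ≤ 0.613 * W := by
    refine abs_le_of_sq_le_sq' ?_ (by positivity) |>.2
    nlinarith
  have hQge : 0.79 * W ≤ Q := by
    refine abs_le_of_sq_le_sq' ?_ hQ0 |>.2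
    nlinarith
  have hQpos : 0 < Q := by nlinarith
  have hdiv : a ^ 2 * Q ≤ Δ ^ 2 * W + a * Δ * P := by
    refine le_of_mul_le_mul_right ?_ hQpos
    nlinarith
  have had : Δ ≤ 0.578 * a := by
    refine abs_le_of_sq_le_sq' ?_ (by positivity) |>.2
    nlinarith
  have ha2 : 0 < a ^ 2 := by positivity
  have h1 : Δ ^ 2 * W ≤ a ^ 2 / 3 * W := by gcongr; linarith
  have h2 : a * Δ * P ≤ a * (0.578 * a) * (0.613 * W) := by gcongr
  have h3 : a ^ 2 * (0.79 * W) ≤ a ^ 2 * Q := by gcongr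
  have h4 : 0 < a ^ 2 * W := by positivity
  nlinarith

namespace IsQuadraticEigenvector

variable {lam : ι → ℝ} {b : ι → F} {ν : ℂ} {w : ι → ℂ}

theorem sum_norm_sq_pos (h : IsQuadraticEigenvector lam b ν w) : 0 < ∑ j, ‖w j‖ ^ 2 := by
  obtain ⟨j, hj⟩ := Function.ne_iff.mp h.ne_zero
  exact Finset.sum_pos' (fun _ _ => by positivity)
    ⟨j, Finset.mem_univ j, by have := norm_pos_iff.mpr hj; positivity⟩

theorem sum_sq_mul_norm_sq (h : IsQuadraticEigenvector lam b ν w) :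
    ∑ j, (Complex.I * lam j - ν) ^ 2 * (‖w j‖ ^ 2 : ℝ) = (‖∑ i, w i • b i‖ ^ 2 : ℝ) := by
  have h1 := sum_conj_mul_inner b w (∑ i, w i • b i)
  rw [inner_self_eq_norm_sq_to_K] at h1
  push_cast
  refine Eq.trans ?_ h1
  refine Finset.sum_congr rfl fun j _ => ?_
  rw [← h.eq j, ← Complex.ofReal_pow, ← Complex.normSq_eq_norm_sq, ← Complex.mul_conj]
  ring

theorem sum_re (h : IsQuadraticEigenvector lam b ν w) :
    ∑ j, (ν.re ^ 2 - (lam j - ν.im) ^ 2) * ‖w j‖ ^ 2 = ‖∑ i, w i • b i‖ ^ 2 := by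
  have h1 := congrArg Complex.re h.sum_sq_mul_norm_sq
  rw [Complex.ofReal_re, Complex.re_sum] at h1
  rw [← h1]
  refine Finset.sum_congr rfl fun j _ => ?_
  rw [Complex.re_mul_ofReal]
  simp [pow_two]

theorem sum_im (h : IsQuadraticEigenvector lam b ν w) (hν : ν.re ≠ 0) :
    ∑ j, (lam j - ν.im) * ‖w j‖ ^ 2 = 0 := by
  have h1 := congrArg Complex.im h.sum_sq_mul_norm_sq
  rw [Complex.ofReal_im, Complex.im_sum] at h1
  have h2 : (-2 * ν.re) * ∑ j, (lam j - ν.im) * ‖w j‖ ^ 2 = 0 := by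
    rw [← h1, Finset.mul_sum]
    refine Finset.sum_congr rfl fun j _ => ?_
    rw [Complex.im_mul_ofReal]
    simp [pow_two]
    ring
  exact (mul_eq_zero.mp h2).resolve_left (by simpa using hν)

/-- Sums the squared moduli of the component equations, whereas `sum_sq_mul_norm_sq` pairs them with
`w`. -/
theorem sum_norm_pow_four_le (h : IsQuadraticEigenvector lam b ν w) {β : ℝ}
    (hb : ∀ u : ι → ℂ, ‖∑ i, u i • b i‖ ^ 2 ≤ β ^ 2 * ∑ i, ‖u i‖ ^ 2) :
    ∑ j, ((lam j - ν.im) ^ 2 + ν.re ^ 2) ^ 2 * ‖w j‖ ^ 2 ≤ β ^ 2 * ‖∑ i, w i • b i‖ ^ 2 := by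
  refine le_trans (le_of_eq ?_) (sum_norm_inner_sq_le hb _)
  refine Finset.sum_congr rfl fun j _ => ?_
  rw [← h.eq j, norm_mul, norm_pow, ← norm_sq_I_mul_sub]
  ring

theorem output_ne_zero (h : IsQuadraticEigenvector lam b ν w) (hν : ν.re ≠ 0) :
    ∑ i, w i • b i ≠ 0 := by
  intro h0
  refine h.ne_zero (funext fun j => ?_)
  have h1 := h.eq j
  rw [h0, inner_zero_right] at h1
  refine (mul_eq_zero.mp h1).resolve_left fun h2 => hν ?_
  have h3 := congrArg Complex.re (pow_eq_zero_iff (two_ne_zero)|>.mp h2)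
  simpa using h3

theorem abs_re_le (h : IsQuadraticEigenvector lam b ν w) {β : ℝ} (hβ : 0 ≤ β)
    (hb : ∀ u : ι → ℂ, ‖∑ i, u i • b i‖ ^ 2 ≤ β ^ 2 * ∑ i, ‖u i‖ ^ 2) : |ν.re| ≤ β := by
  have h1 : (ν.re ^ 2) ^ 2 * ∑ j, ‖w j‖ ^ 2 ≤ (β ^ 2) ^ 2 * ∑ j, ‖w j‖ ^ 2 := by
    calc (ν.re ^ 2) ^ 2 * ∑ j, ‖w j‖ ^ 2
        ≤ ∑ j, ((lam j - ν.im) ^ 2 + ν.re ^ 2) ^ 2 * ‖w j‖ ^ 2 := by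
          rw [Finset.mul_sum]
          refine Finset.sum_le_sum fun j _ => ?_
          gcongr
          nlinarith [sq_nonneg (lam j - ν.im)]
      _ ≤ β ^ 2 * ‖∑ i, w i • b i‖ ^ 2 := h.sum_norm_pow_four_le hb
      _ ≤ β ^ 2 * (β ^ 2 * ∑ j, ‖w j‖ ^ 2) := by gcongr; exact hb w
      _ = _ := by ring
  have h2 := le_of_mul_le_mul_right h1 h.sum_norm_sq_pos
  have h3 := (pow_le_pow_iff_left₀ (sq_nonneg _) (sq_nonneg _) two_ne_zero).mp h2
  exact abs_le_of_sq_le_sq h3 hβ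

/-- By `sum_im`, `ν.im` is the mean of the `lam j` with weights `‖w j‖ ^ 2`. -/
theorem im_mem_Icc (h : IsQuadraticEigenvector lam b ν w) (hν : ν.re ≠ 0) {lo hi : ℝ}
    (hlam : ∀ j, lam j ∈ Set.Icc lo hi) : ν.im ∈ Set.Icc lo hi := by
  have h1 := h.sum_im hν
  simp only [sub_mul, Finset.sum_sub_distrib, ← Finset.mul_sum] at h1
  have hlo : lo * ∑ j, ‖w j‖ ^ 2 ≤ ∑ j, lam j * ‖w j‖ ^ 2 := by
    rw [Finset.mul_sum]
    exact Finset.sum_le_sum fun j _ => by gcongr; exact (hlam j).1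
  have hhi : ∑ j, lam j * ‖w j‖ ^ 2 ≤ hi * ∑ j, ‖w j‖ ^ 2 := by
    rw [Finset.mul_sum]
    exact Finset.sum_le_sum fun j _ => by gcongr; exact (hlam j).2
  have hpos := h.sum_norm_sq_pos
  exact ⟨le_of_mul_le_mul_right (by linarith) hpos, le_of_mul_le_mul_right (by linarith) hpos⟩

/-- Otherwise every term of `sum_re` is nonpositive, although its total `‖∑ w_i b_i‖²` is positive.
-/
theorem exists_abs_sub_lt (h : IsQuadraticEigenvector lam b ν w) (hν : ν.re ≠ 0) :
    ∃ j, |lam j - ν.im| < |ν.re| := by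
  by_contra! hc
  have h1 : ∑ j, (ν.re ^ 2 - (lam j - ν.im) ^ 2) * ‖w j‖ ^ 2 ≤ 0 :=
    Finset.sum_nonpos fun j _ =>
      mul_nonpos_of_nonpos_of_nonneg (sub_nonpos.mpr (sq_le_sq.mpr (hc j))) (by positivity)
  rw [h.sum_re] at h1
  have := norm_pos_iff.mpr (h.output_ne_zero hν)
  nlinarith

/-- If `ν` is closer to `i λ_k` than `δ / √2`, where `δ` bounds the distance from `λ_k` to the other
eigenvalues from below, then the component `w k` dominates. -/
theorem component_bounds (h : IsQuadraticEigenvector lam b ν w) (hν : ν.re < 0) {β : ℝ}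
    (hβ : 0 < β) (hb : ∀ u : ι → ℂ, ‖∑ i, u i • b i‖ ^ 2 ≤ β ^ 2 * ∑ i, ‖u i‖ ^ 2) {k : ι} {δ : ℝ}
    (hδ : 0 < δ) (hsep : ∀ j, j ≠ k → δ ≤ |lam j - lam k|)
    (hr : (lam k - ν.im) ^ 2 + ν.re ^ 2 ≤ δ ^ 2 / 2) :
    ‖∑ i, w i • b i‖ ≤ -ν.re * ‖w k‖ ∧
      ‖w k‖ * ‖b k‖ < (1 + 2 * (β ^ 2 / δ ^ 2)) * ‖∑ i, w i • b i‖ := by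
  classical
  set a := -ν.re with ha
  set y := ν.im with hy
  set f := ∑ i, w i • b i with hf
  set s := |lam k - y| with hs
  have ha0 : 0 < a := by linarith
  have hs0 : 0 ≤ s := abs_nonneg _
  have hre : ν.re ^ 2 = a ^ 2 := by rw [ha]; ring
  have hs2 : (lam k - y) ^ 2 = s ^ 2 := (sq_abs _).symm
  have hfpos : 0 < ‖f‖ := norm_pos_iff.mpr (h.output_ne_zero hν.ne)
  rw [hre, hs2] at hr
  have hsum : s + a ≤ δ := by nlinarith [sq_nonneg (s - a)]
  have hfar : ∀ j, j ≠ k → δ - s ≤ |lam j - y| := fun j hj => by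
    have h1 := hsep j hj
    have h2 : |lam j - lam k| ≤ |lam j - y| + s := by
      have := abs_sub_le (lam j) y (lam k)
      rwa [abs_sub_comm y (lam k)] at this
    linarith
  -- The index supplied by `exists_abs_sub_lt` must be `k`, as every other `λ_j` is at distance at
  -- least `δ - s ≥ a` from `y`.
  have hsa : s < a := by
    obtain ⟨j, hj⟩ := h.exists_abs_sub_lt hν.ne
    rw [abs_of_neg hν, ← ha, ← hy] at hj
    by_cases hjk : j = k
    · rwa [hjk] at hj
    · have := hfar j hjk
      linarith
  have hfar2 : ∀ j, j ≠ k → (δ - s) ^ 2 ≤ (lam j - y) ^ 2 := fun j hj => by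
    rw [← sq_abs (lam j - y)]
    exact pow_le_pow_left₀ (by linarith) (hfar j hj) 2
  have hre1 := h.sum_re
  rw [← Finset.add_sum_erase _ _ (Finset.mem_univ k), ← hf] at hre1
  have hrest : ∑ j ∈ Finset.univ.erase k, (ν.re ^ 2 - (lam j - ν.im) ^ 2) * ‖w j‖ ^ 2 ≤ 0 :=
    Finset.sum_nonpos fun j hj => mul_nonpos_of_nonpos_of_nonneg (by
      have := hfar2 j (Finset.ne_of_mem_erase hj)
      rw [hre]
      nlinarith) (by positivity)
  have hfc : ‖f‖ ^ 2 ≤ (a * ‖w k‖) ^ 2 := by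
    rw [← hre1, mul_pow]
    have h1 : (ν.re ^ 2 - (lam k - ν.im) ^ 2) * ‖w k‖ ^ 2 ≤ a ^ 2 * ‖w k‖ ^ 2 := by
      rw [hre]
      gcongr
      linarith [sq_nonneg (lam k - ν.im)]
    linarith
  have hfa : ‖f‖ ≤ a * ‖w k‖ :=
    (pow_le_pow_iff_left₀ hfpos.le (by positivity) two_ne_zero).mp hfc
  refine ⟨hfa, ?_⟩
  have hwk : 0 < ‖w k‖ := by
    by_contra hc
    have : ‖w k‖ = 0 := le_antisymm (not_lt.mp hc) (norm_nonneg _)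
    rw [this] at hfa
    linarith
  set W := ∑ j ∈ Finset.univ.erase k, ‖w j‖ ^ 2 with hW
  have hW0 : 0 ≤ W := Finset.sum_nonneg fun _ _ => by positivity
  have hfour := h.sum_norm_pow_four_le hb
  rw [← Finset.add_sum_erase _ _ (Finset.mem_univ k), ← hf] at hfour
  have hWlt : (δ ^ 2 / 2) ^ 2 * W < (β * ‖f‖) ^ 2 := by
    have h1 : (δ ^ 2 / 2) ^ 2 * W ≤ ∑ j ∈ Finset.univ.erase k,
        ((lam j - ν.im) ^ 2 + ν.re ^ 2) ^ 2 * ‖w j‖ ^ 2 := by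
      rw [hW, Finset.mul_sum]
      refine Finset.sum_le_sum fun j hj => ?_
      have := hfar2 j (Finset.ne_of_mem_erase hj)
      gcongr
      rw [hre]
      -- As `s < a`, `(δ - s)² + a² ≥ (δ - s)² + s² ≥ δ² / 2`.
      nlinarith [sq_nonneg (δ - 2 * s)]
    have h2 : 0 < ((lam k - ν.im) ^ 2 + ν.re ^ 2) ^ 2 * ‖w k‖ ^ 2 := by
      rw [hre]; positivity
    rw [mul_pow]
    linarith
  have hsqW : √W < 2 * β / δ ^ 2 * ‖f‖ := by
    rw [Real.sqrt_lt' (by positivity)]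
    have : (2 * β / δ ^ 2 * ‖f‖) ^ 2 = (β * ‖f‖) ^ 2 / (δ ^ 2 / 2) ^ 2 := by
      field_simp
    rw [this, lt_div_iff₀ (by positivity)]
    linarith
  -- Isolating the `k`-th term leaves a remainder controlled by `β √W`, hence by `2 β² / δ² * ‖f‖`.
  have hdecomp : w k • b k = f - ∑ i, (Function.update w k 0) i • b i := by
    rw [hf, ← Finset.add_sum_erase _ _ (Finset.mem_univ k),
      ← Finset.add_sum_erase (Finset.univ) (fun i => Function.update w k 0 i • b i)
        (Finset.mem_univ k),
      Finset.sum_congr rfl (g := fun i => w i • b i) (s₁ := Finset.univ.erase k)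
        (f := fun i => Function.update w k 0 i • b i)]
    · simp
    · intro i hi
      rw [Function.update_of_ne (Finset.ne_of_mem_erase hi)]
  have hbW : ‖∑ i, (Function.update w k 0) i • b i‖ ≤ β * √W := by
    have h1 := hb (Function.update w k 0)
    rw [← Finset.add_sum_erase (Finset.univ) (fun i => ‖Function.update w k 0 i‖ ^ 2)
        (Finset.mem_univ k),
      Finset.sum_congr rfl (g := fun i => ‖w i‖ ^ 2) (s₁ := Finset.univ.erase k)
        (f := fun i => ‖Function.update w k 0 i‖ ^ 2)] at h1
    · simp only [Function.update_self, norm_zero, ne_eq, OfNat.ofNat_ne_zero, not_false_eq_true,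
        zero_pow, zero_add] at h1
      refine (pow_le_pow_iff_left₀ (norm_nonneg _) (by positivity) two_ne_zero).mp ?_
      rwa [mul_pow, Real.sq_sqrt hW0]
    · intro i hi
      rw [Function.update_of_ne (Finset.ne_of_mem_erase hi)]
  calc ‖w k‖ * ‖b k‖ = ‖f - ∑ i, (Function.update w k 0) i • b i‖ := by
        rw [← hdecomp, norm_smul]
    _ ≤ ‖f‖ + β * √W := (norm_sub_le _ _).trans (by gcongr)
    _ < ‖f‖ + β * (2 * β / δ ^ 2 * ‖f‖) := by gcongr
    _ = _ := by ring

theorem sq_mul_norm_eq (h : IsQuadraticEigenvector lam b ν w) (k : ι) :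
    ((lam k - ν.im) ^ 2 + ν.re ^ 2) * ‖w k‖ = ‖⟪b k, ∑ i, w i • b i⟫_ℂ‖ := by
  rw [← h.eq k, norm_mul, norm_pow, norm_sq_I_mul_sub]

/-- A real part of modulus between `√3 (hi - lo)` and `√6 σ / 4` is impossible. Here `q` is the part of
`w` that is not seen by `b`. -/
theorem gap (h : IsQuadraticEigenvector lam b ν w) (hν : ν.re < 0) {lo hi σ : ℝ} (hσ : 0 < σ)
    (hlam : ∀ j, lam j ∈ Set.Icc lo hi) {p q : ι → ℂ} (hw : w = p + q)
    (hq : ∑ i, q i • b i = 0) (hpq : ∑ i, (starRingEnd ℂ) (q i) * p i = 0)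
    (hp : σ ^ 2 * ∑ i, ‖p i‖ ^ 2 ≤ ‖∑ i, w i • b i‖ ^ 2)
    (hlow : 3 * (hi - lo) ^ 2 ≤ ν.re ^ 2) : 3 / 8 * σ ^ 2 ≤ ν.re ^ 2 := by
  by_contra! hc
  have hW := h.sum_norm_sq_pos
  have him := h.im_mem_Icc hν.ne hlam
  have hΔ : 0 ≤ hi - lo := by linarith [him.1, him.2]
  have hfa : ‖∑ i, w i • b i‖ ^ 2 ≤ ν.re ^ 2 * ∑ j, ‖w j‖ ^ 2 := by
    rw [← h.sum_re, Finset.mul_sum]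
    refine Finset.sum_le_sum fun j _ => ?_
    gcongr
    linarith [sq_nonneg (lam j - ν.im)]
  have hpyth : ∑ j, ‖w j‖ ^ 2 = ∑ j, ‖p j‖ ^ 2 + ∑ j, ‖q j‖ ^ 2 := by
    have h1 := congrArg Complex.re hpq
    rw [Complex.re_sum, Complex.zero_re] at h1
    rw [← Finset.sum_add_distrib, ← add_zero (∑ j, (‖p j‖ ^ 2 + ‖q j‖ ^ 2)),
      ← mul_zero (2 : ℝ), ← h1, Finset.mul_sum, ← Finset.sum_add_distrib]
    refine Finset.sum_congr rfl fun j _ => ?_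
    rw [hw]
    simp only [Pi.add_apply, ← Complex.normSq_eq_norm_sq, Complex.normSq_apply, Complex.add_re,
      Complex.add_im, Complex.mul_re, Complex.conj_re, Complex.conj_im]
    ring
  have hortho := sum_conj_mul_inner b q (∑ i, w i • b i)
  rw [hq, inner_zero_left] at hortho
  -- The eigenvalue equation paired with `q`, whose right side vanishes. Since `q ⟂ p`, the shift
  -- `ν.im` in the `p`-term may be replaced by the midpoint of `[lo, hi]`, which halves the bound;
  -- the last term is purely imaginary and drops out of the real part.
  have hexpand : ((ν.re ^ 2 * ∑ j, ‖q j‖ ^ 2 : ℝ) : ℂ) =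
      ∑ j, ((lam j - ν.im) ^ 2 : ℝ) * ((starRingEnd ℂ) (q j) * w j)
      + 2 * ν.re * Complex.I * ∑ j, (lam j - (lo + hi) / 2 : ℝ) * ((starRingEnd ℂ) (q j) * p j)
      + 2 * ν.re * Complex.I * (∑ j, (lam j - ν.im) * ‖q j‖ ^ 2 : ℝ) := by
    have h1 : ∀ j, (starRingEnd ℂ) (q j) * ⟪b j, ∑ i, w i • b i⟫_ℂ =
        ν.re ^ 2 * ((‖q j‖ ^ 2 : ℝ) : ℂ)
        - ((lam j - ν.im) ^ 2 : ℝ) * ((starRingEnd ℂ) (q j) * w j)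
        - 2 * ν.re * Complex.I * ((lam j - (lo + hi) / 2 : ℝ) * ((starRingEnd ℂ) (q j) * p j))
        - 2 * ν.re * Complex.I * ((lam j - ν.im) * ‖q j‖ ^ 2 : ℝ)
        + (ν.re ^ 2 - 2 * ν.re * Complex.I * ((lo + hi) / 2 - ν.im)) *
          ((starRingEnd ℂ) (q j) * p j) := fun j => by
      rw [← h.eq j, ← Complex.normSq_eq_norm_sq, hw, Pi.add_apply]
      push_cast
      rw [Complex.normSq_eq_conj_mul_self]
      conv_lhs => rw [← Complex.re_add_im ν]
      linear_combination ((starRingEnd ℂ) (q j) * (p j + q j)) * (lam j - ν.im) ^ 2 *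
        Complex.I_sq
    simp only [h1, Finset.sum_add_distrib, Finset.sum_sub_distrib, ← Finset.mul_sum, hpq] at hortho
    push_cast at hortho ⊢
    linear_combination hortho
  obtain ⟨P, hP⟩ : ∃ P, P = √(∑ j, ‖p j‖ ^ 2) := ⟨_, rfl⟩
  obtain ⟨Q, hQ⟩ : ∃ Q, Q = √(∑ j, ‖q j‖ ^ 2) := ⟨_, rfl⟩
  obtain ⟨W, hWdef⟩ : ∃ W, W = √(∑ j, ‖w j‖ ^ 2) := ⟨_, rfl⟩
  have hP2 : P ^ 2 = ∑ j, ‖p j‖ ^ 2 := by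
    rw [hP, Real.sq_sqrt (Finset.sum_nonneg fun _ _ => by positivity)]
  have hQ2 : Q ^ 2 = ∑ j, ‖q j‖ ^ 2 := by
    rw [hQ, Real.sq_sqrt (Finset.sum_nonneg fun _ _ => by positivity)]
  have hW2 : W ^ 2 = ∑ j, ‖w j‖ ^ 2 := by rw [hWdef, Real.sq_sqrt hW.le]
  have hP0 : 0 ≤ P := hP ▸ Real.sqrt_nonneg _
  have hQ0 : 0 ≤ Q := hQ ▸ Real.sqrt_nonneg _
  have hW0 : 0 < W := hWdef ▸ Real.sqrt_pos.mpr hW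
  have hest1 : ‖∑ j, ((lam j - ν.im) ^ 2 : ℝ) * ((starRingEnd ℂ) (q j) * w j)‖ ≤
      (hi - lo) ^ 2 * (Q * W) := by
    rw [hQ, hWdef]
    refine norm_sum_conj_mul_le (sq_nonneg _) (fun j => ?_) q w
    rw [abs_of_nonneg (sq_nonneg _)]
    exact sq_le_sq' (by linarith [(hlam j).1, him.2]) (by linarith [(hlam j).2, him.1])
  have hest2 : ‖∑ j, (lam j - (lo + hi) / 2 : ℝ) * ((starRingEnd ℂ) (q j) * p j)‖ ≤
      (hi - lo) / 2 * (Q * P) := by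
    rw [hQ, hP]
    refine norm_sum_conj_mul_le (by linarith) (fun j => ?_) q p
    rw [abs_le]
    exact ⟨by linarith [(hlam j).1], by linarith [(hlam j).2]⟩
  obtain ⟨a, ha⟩ : ∃ a, a = -ν.re := ⟨_, rfl⟩
  have hre : ν.re ^ 2 = a ^ 2 := by rw [ha]; ring
  have ha0 : 0 < a := by linarith
  have hkey : a ^ 2 * Q ^ 2 ≤ (hi - lo) ^ 2 * (Q * W) + a * (hi - lo) * (Q * P) := by
    have h1 := congrArg Complex.re hexpand
    rw [Complex.ofReal_re, Complex.add_re, Complex.add_re] at h1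
    have h2 : (2 * ν.re * Complex.I * (∑ j, (lam j - ν.im) * ‖q j‖ ^ 2 : ℝ)).re = 0 := by
      rw [Complex.re_mul_ofReal]; simp
    have h3 := (Complex.re_le_norm _).trans hest1
    have h4 := (Complex.re_le_norm (2 * ν.re * Complex.I *
      ∑ j, (lam j - (lo + hi) / 2 : ℝ) * ((starRingEnd ℂ) (q j) * p j)))
    rw [norm_mul, show ‖2 * (ν.re : ℂ) * Complex.I‖ = 2 * a by
      simp [abs_of_neg hν, ha]] at h4
    have h5 := mul_le_mul_of_nonneg_left hest2 (show 0 ≤ 2 * a by positivity)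
    rw [← hre, hQ2]
    linarith
  rw [← hP2, ← hQ2, ← hW2] at hpyth
  rw [← hP2] at hp
  rw [← hW2] at hfa
  rw [hre] at hc hfa hlow
  exact gap_arithmetic hσ ha0 hW0 hP0 hQ0 hpyth (hp.trans hfa) hlow hc hkey

end IsQuadraticEigenvector

end QuadraticEigenvalue

/-! ### Continuity of the eigenvalue count. -/

section RootCount

open Filter Topology Polynomial

theorem numIn_ofFn {N : ℕ} (r : Fin N → ℂ) (S : Set ℂ) [DecidablePred (· ∈ S)] :
    numIn (Multiset.ofList (List.ofFn r)) S = (Finset.univ.filter fun i => r i ∈ S).card := by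
  classical
  have : (Multiset.ofList (List.ofFn r)) = (Finset.univ : Finset (Fin N)).val.map r := by
    simp [Fin.univ_def, List.ofFn_eq_map]
  rw [numIn, this, Multiset.filter_map, Multiset.card_map, Finset.card_def, Finset.filter_val]
  congr!

theorem exists_prod_eq_charpoly {N : ℕ} (M : Matrix (Fin N) (Fin N) ℂ) :
    ∃ r : Fin N → ℂ, M.charpoly.roots = Multiset.ofList (List.ofFn r) ∧
      M.charpoly = ∏ i, (X - C (r i)) := by
  have hs : M.charpoly.Splits := IsAlgClosed.splits _
  have hc : M.charpoly.roots.toList.length = N := by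
    rw [Multiset.length_toList, ← hs.natDegree_eq_card_roots, Matrix.charpoly_natDegree_eq_dim,
      Fintype.card_fin]
  have hr : M.charpoly.roots =
      Multiset.ofList (List.ofFn fun i : Fin N => M.charpoly.roots.toList[i]) := by
    conv_lhs => rw [← Multiset.coe_toList M.charpoly.roots]
    congr 1
    apply List.ext_getElem <;> simp [hc]
  refine ⟨_, hr, ?_⟩
  conv_lhs => rw [hs.eq_prod_roots_of_monic M.charpoly_monic, hr]
  simp [List.map_ofFn, List.prod_ofFn]

theorem norm_le_of_mem_roots_charpoly {N : ℕ} [NeZero N] {M : Matrix (Fin N) (Fin N) ℂ} {z : ℂ}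
    (hz : z ∈ M.charpoly.roots) : ‖z‖ ≤ ‖M‖ := by
  have h1 : z ∈ spectrum ℂ M :=
    Matrix.mem_spectrum_iff_isRoot_charpoly.mpr (isRoot_of_mem_roots hz)
  have := spectrum.norm_le_norm_mul_of_mem h1
  simpa using this

/-- If the eigenvalues of a matrix avoid the common boundary of the open sets `U` and `V`, the number
of eigenvalues in `U` does not change under small perturbations. -/
theorem eventually_numIn_roots_charpoly_eq {T : Type*} [TopologicalSpace T]
    [FirstCountableTopology T] {N : ℕ} {H : T → Matrix (Fin N) (Fin N) ℂ} {t : T}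
    (hH : ContinuousAt H t) {U V : Set ℂ} (hU : IsOpen U) (hV : IsOpen V) (hUV : Disjoint U V)
    (hroot : ∀ z ∈ (H t).charpoly.roots, z ∈ U ∪ V) :
    ∀ᶠ s in 𝓝 t, numIn (H s).charpoly.roots U = numIn (H t).charpoly.roots U := by
  classical
  rcases Nat.eq_zero_or_pos N with rfl | hN
  · refine Eventually.of_forall fun s => ?_
    rw [Subsingleton.elim (H s) (H t)]
  have : NeZero N := ⟨hN.ne'⟩
  by_contra hcon
  obtain ⟨s, hs, hne⟩ := exists_seq_forall_of_frequently (not_eventually.mp hcon)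
  have hHs : Tendsto (fun k => H (s k)) atTop (𝓝 (H t)) := hH.tendsto.comp hs
  choose r hr hrp using fun k => exists_prod_eq_charpoly (H (s k))
  obtain ⟨R, hR⟩ := (Metric.isBounded_range_of_tendsto _ hHs).exists_norm_le
  -- Eigenvalues are bounded by the matrix norm, so the root tuples have a convergent subsequence;
  -- its limit lists the roots of the limiting characteristic polynomial.
  have hrR : ∀ k, r k ∈ Metric.closedBall (0 : Fin N → ℂ) (max R 0) := fun k => by
    rw [mem_closedBall_zero_iff, pi_norm_le_iff_of_nonneg (le_max_right _ _)]
    intro i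
    refine le_trans ?_ (le_max_left _ _)
    refine le_trans (norm_le_of_mem_roots_charpoly (M := H (s k)) ?_) (hR _ ⟨k, rfl⟩)
    rw [hr k]
    simp [List.mem_ofFn]
  obtain ⟨r₀, -, φ, hφ, hlim⟩ := (isCompact_closedBall _ _).tendsto_subseq hrR
  have hlim' := tendsto_pi_nhds.mp hlim
  have hpoly : (H t).charpoly = ∏ i, (X - C (r₀ i)) := by
    refine Polynomial.funext fun z => ?_
    have h1 : Tendsto (fun k => (H (s (φ k))).charpoly.eval z) atTop
        (𝓝 ((H t).charpoly.eval z)) := by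
      simp only [Matrix.eval_charpoly]
      have hc : Continuous fun M : Matrix (Fin N) (Fin N) ℂ => (Matrix.scalar (Fin N) z - M).det :=
        (continuous_const.sub continuous_id).matrix_det
      exact (hc.tendsto _).comp (hHs.comp hφ.tendsto_atTop)
    refine tendsto_nhds_unique h1 ?_
    simp only [hrp, eval_prod, eval_sub, eval_X, eval_C]
    exact tendsto_finsetProd _ fun i _ => (hlim' i).const_sub z
  have hroots : (H t).charpoly.roots = Multiset.ofList (List.ofFn r₀) := by
    have h1 : ∏ i, (X - C (r₀ i)) =
        ((Multiset.ofList (List.ofFn r₀)).map fun a => X - C a).prod := by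
      simp [List.map_ofFn, List.prod_ofFn]
    rw [hpoly, h1, roots_multiset_prod_X_sub_C]
  have hev : ∀ᶠ k in atTop, ∀ i, (r (φ k) i ∈ U ↔ r₀ i ∈ U) := by
    refine eventually_all.mpr fun i => ?_
    rcases hroot (r₀ i) (by rw [hroots]; simp [List.mem_ofFn]) with h | h
    · filter_upwards [(hlim' i).eventually_mem (hU.mem_nhds h)] with k hk
      exact ⟨fun _ => h, fun _ => hk⟩
    · filter_upwards [(hlim' i).eventually_mem (hV.mem_nhds h)] with k hk
      exact ⟨fun h' => (Set.disjoint_left.mp hUV h' hk).elim,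
        fun h' => (Set.disjoint_left.mp hUV h' h).elim⟩
  obtain ⟨k, hk⟩ := hev.exists
  refine hne (φ k) ?_
  rw [hr, hroots, numIn_ofFn, numIn_ofFn]
  simp only [hk]

theorem numIn_roots_charpoly_eq_of_continuous {T ι : Type*} [TopologicalSpace T]
    [FirstCountableTopology T] [PreconnectedSpace T] [Fintype ι] [DecidableEq ι]
    {H : T → Matrix ι ι ℂ} (hH : Continuous H) {U V : Set ℂ} (hU : IsOpen U)
    (hV : IsOpen V) (hUV : Disjoint U V) (hroot : ∀ t, ∀ z ∈ (H t).charpoly.roots, z ∈ U ∪ V)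
    (s t : T) : numIn (H s).charpoly.roots U = numIn (H t).charpoly.roots U := by
  set e := Fintype.equivFin ι
  have he : ∀ t, ((H t).submatrix e.symm e.symm).charpoly = (H t).charpoly :=
    fun t => Matrix.charpoly_reindex e (H t)
  have h : IsLocallyConstant fun t => numIn (H t).charpoly.roots U := by
    refine (IsLocallyConstant.iff_eventually_eq _).mpr fun t => ?_
    have := eventually_numIn_roots_charpoly_eq
      (hH.matrix_submatrix e.symm e.symm).continuousAt (t := t) hU hV hUV
      (by rw [he]; exact hroot t)
    simpa only [he] using this
  exact h.apply_eq_of_isPreconnected isPreconnected_univ (Set.mem_univ _) (Set.mem_univ _)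

end RootCount

/-! ### Elimination of the Riccati solution. -/

section Riccati

variable {n m : ℕ} {A : Matrix (Fin n) (Fin n) ℂ} {B : Matrix (Fin n) (Fin m) ℂ}
  {X : Matrix (Fin n) (Fin n) ℂ}

/-- If `X u = 0`, the quadratic form of the Riccati equation at `u` reduces to `-‖u‖² = 0`. -/
theorem IsRiccatiSolution.posDef (hX : IsRiccatiSolution A B X) : X.PosDef := by
  refine hX.posSemidef.posDef_iff_isUnit.mpr ?_
  rw [Matrix.isUnit_iff_isUnit_det, isUnit_iff_ne_zero]
  intro hdet
  obtain ⟨u, hu0, hu⟩ := Matrix.exists_mulVec_eq_zero_iff.mpr hdet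
  have hu' : star u ᵥ* X = 0 := by
    have := congrArg star hu
    rwa [Matrix.star_mulVec, hX.posSemidef.isHermitian.eq, star_zero] at this
  have hXu : ∀ y, star u ⬝ᵥ X *ᵥ y = 0 := fun y => by
    rw [Matrix.dotProduct_mulVec, hu', zero_dotProduct]
  have h := congrArg (fun M => star u ⬝ᵥ M *ᵥ u) hX.care
  simp only [Matrix.sub_mulVec, dotProduct_sub, ← Matrix.mulVec_mulVec, hu, Matrix.mulVec_zero,
    dotProduct_zero, dotProduct_neg, hXu, Matrix.one_mulVec,
    Matrix.zero_mulVec, zero_sub, sub_zero, neg_zero, neg_eq_zero, dotProduct_star_self_eq_zero] at h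
  exact hu0 h

theorem IsRiccatiSolution.mul_conjTranspose_eq (hX : IsRiccatiSolution A B X) (hA : Aᴴ = -A) :
    B * Bᴴ = X⁻¹ * X⁻¹ + A * X⁻¹ - X⁻¹ * A := by
  have hu : IsUnit X.det := (Matrix.isUnit_iff_isUnit_det _).mp hX.posDef.isUnit
  have h1 : X * (B * Bᴴ) * X = X * A - A * X + 1 := by
    have := hX.care
    rw [hA] at this
    rw [← sub_eq_zero, ← this]
    simp only [Matrix.mul_assoc]
    noncomm_ring
  have h2 : X⁻¹ * (X * (B * Bᴴ) * X) * X⁻¹ = B * Bᴴ := by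
    rw [← Matrix.mul_assoc, ← Matrix.mul_assoc, Matrix.nonsing_inv_mul _ hu, Matrix.one_mul,
      Matrix.mul_assoc, Matrix.mul_nonsing_inv _ hu, Matrix.mul_one]
  rw [← h2, h1, Matrix.mul_add, Matrix.mul_sub, ← Matrix.mul_assoc, Matrix.nonsing_inv_mul _ hu,
    Matrix.add_mul, Matrix.sub_mul, Matrix.one_mul, Matrix.mul_one, Matrix.mul_assoc X⁻¹ (A * X),
    Matrix.mul_assoc A X, Matrix.mul_nonsing_inv _ hu, Matrix.mul_one]
  abel

/-- The Riccati equation says `X (A - B Bᴴ X) = (A - X⁻¹) X`, so the two matrices are similar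
through `X`. -/
theorem IsRiccatiSolution.charpoly_closedLoop (hX : IsRiccatiSolution A B X) (hA : Aᴴ = -A) :
    (closedLoop A B X).charpoly = (A - X⁻¹).charpoly := by
  have hu : IsUnit X.det := (Matrix.isUnit_iff_isUnit_det _).mp hX.posDef.isUnit
  have h1 : X * closedLoop A B X = (A - X⁻¹) * X := by
    rw [Matrix.sub_mul, Matrix.nonsing_inv_mul _ hu, closedLoop, ← sub_eq_zero, ← neg_eq_zero,
      ← hX.care, hA]
    simp only [Matrix.mul_assoc]
    noncomm_ring
  have h2 : closedLoop A B X = X⁻¹ * ((A - X⁻¹) * X) := by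
    rw [← h1, ← Matrix.mul_assoc, Matrix.nonsing_inv_mul _ hu, Matrix.one_mul]
  rw [h2, Matrix.charpoly_mul_comm, Matrix.mul_assoc, Matrix.mul_nonsing_inv _ hu, Matrix.mul_one]

end Riccati

/-! ### Linearisation and factorisation of the quadratic problem. -/

section Companion

variable {ι : Type*} [Fintype ι] [DecidableEq ι]

theorem exists_mulVec_eq_smul_of_mem_roots {M : Matrix ι ι ℂ} {z : ℂ} (hz : z ∈ M.charpoly.roots) :
    ∃ w : ι → ℂ, w ≠ 0 ∧ M *ᵥ w = z • w := by
  have h1 := Polynomial.isRoot_of_mem_roots hz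
  rw [Polynomial.IsRoot.def, Matrix.eval_charpoly] at h1
  obtain ⟨w, hw, h⟩ := Matrix.exists_mulVec_eq_zero_iff.mpr h1
  refine ⟨w, hw, ?_⟩
  rw [Matrix.sub_mulVec, sub_eq_zero] at h
  rw [← h]
  simp

/-- The companion matrix of the quadratic eigenvalue problem `(A - ν)² w = G w`. -/
def companion (A G : Matrix ι ι ℂ) : Matrix (ι ⊕ ι) (ι ⊕ ι) ℂ :=
  Matrix.fromBlocks A G 1 A

/-- Conjugation by the unipotent block matrix with corner `Y` makes the companion matrix block
triangular: the upper right block becomes `G - (Y² + A Y - Y A) = 0`. -/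
theorem charpoly_companion {A G Y : Matrix ι ι ℂ} (h : G = Y * Y + A * Y - Y * A) :
    (companion A G).charpoly = (A + Y).charpoly * (A - Y).charpoly := by
  have h1 : Matrix.fromBlocks 1 Y 0 1 * (companion A G * Matrix.fromBlocks 1 (-Y) 0 1) =
      Matrix.fromBlocks (A + Y) 0 1 (A - Y) := by
    rw [companion, Matrix.fromBlocks_multiply, Matrix.fromBlocks_multiply, h]
    congr 1 <;> noncomm_ring
  have h2 : (Matrix.fromBlocks 1 (-Y) 0 1 * Matrix.fromBlocks 1 Y 0 1 :
      Matrix (ι ⊕ ι) (ι ⊕ ι) ℂ) = 1 := by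
    rw [Matrix.fromBlocks_multiply, ← Matrix.fromBlocks_one]
    congr 1 <;> noncomm_ring
  rw [← Matrix.charpoly_fromBlocks_zero₁₂ (M₂₁ := 1), ← h1, Matrix.charpoly_mul_comm,
    Matrix.mul_assoc, h2, Matrix.mul_one]

theorem exists_quadratic_eigenvector {A G : Matrix ι ι ℂ} {z : ℂ}
    (hz : z ∈ (companion A G).charpoly.roots) :
    ∃ w : ι → ℂ, w ≠ 0 ∧ A *ᵥ A *ᵥ w - (2 * z) • A *ᵥ w + z ^ 2 • w = G *ᵥ w := by
  obtain ⟨x, hx0, hx⟩ := exists_mulVec_eq_smul_of_mem_roots hz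
  rw [companion, Matrix.fromBlocks_mulVec] at hx
  have h1 := congrArg (· ∘ Sum.inl) hx
  have h2 := congrArg (· ∘ Sum.inr) hx
  simp only [Sum.elim_comp_inl, Sum.elim_comp_inr, Matrix.one_mulVec] at h1 h2
  set u := x ∘ Sum.inl with hu
  set w := x ∘ Sum.inr with hw
  replace h1 : A *ᵥ u + G *ᵥ w = z • u := h1
  replace h2 : u + A *ᵥ w = z • w := h2
  have h3 : u = z • w - A *ᵥ w := eq_sub_of_add_eq h2
  refine ⟨w, fun h0 => hx0 ?_, ?_⟩
  · rw [h0] at h3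
    have hu0 : u = 0 := by simpa using h3
    funext i
    rcases i with i | i
    · exact congrFun hu0 i
    · exact congrFun h0 i
  · rw [eq_sub_of_add_eq' h1, h3, Matrix.mulVec_sub, Matrix.mulVec_smul, smul_sub, smul_smul,
      ← pow_two, mul_smul, two_smul]
    abel

/-- The quadratic form of a skew-Hermitian matrix is purely imaginary, so only `K` contributes to
the real part. -/
theorem re_mul_eq_of_mem_roots {A K : Matrix ι ι ℂ} (hA : Aᴴ = -A) {z : ℂ}
    (hz : z ∈ (A + K).charpoly.roots) :
    ∃ w : ι → ℂ, w ≠ 0 ∧ z.re * (star w ⬝ᵥ w).re = (star w ⬝ᵥ K *ᵥ w).re := by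
  obtain ⟨w, hw0, hw⟩ := exists_mulVec_eq_smul_of_mem_roots hz
  refine ⟨w, hw0, ?_⟩
  have h1 := congrArg (fun u => (star w ⬝ᵥ u).re) hw
  simp only [Matrix.add_mulVec, dotProduct_add, dotProduct_smul, smul_eq_mul, Complex.add_re] at h1
  have h2 : (star w ⬝ᵥ A *ᵥ w).re = 0 := by
    have h3 : star (star w ⬝ᵥ A *ᵥ w) = -(star w ⬝ᵥ A *ᵥ w) := by
      rw [← Matrix.star_dotProduct, Matrix.star_mulVec, hA, ← Matrix.dotProduct_mulVec,
        Matrix.neg_mulVec, dotProduct_neg]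
    have h4 := congrArg Complex.re h3
    simp only [Complex.star_def, Complex.conj_re, Complex.neg_re] at h4
    linarith
  have h5 : (star w ⬝ᵥ w).im = 0 := (Complex.nonneg_iff.mp (dotProduct_star_self_nonneg w)).2.symm
  rw [h2, zero_add, Complex.mul_re, h5, mul_zero, sub_zero] at h1
  exact h1.symm

theorem re_neg_of_mem_roots_sub {A Y : Matrix ι ι ℂ} (hA : Aᴴ = -A) (hY : Y.PosDef) {z : ℂ}
    (hz : z ∈ (A - Y).charpoly.roots) : z.re < 0 := by
  rw [sub_eq_add_neg] at hz
  obtain ⟨w, hw0, hw⟩ := re_mul_eq_of_mem_roots hA hz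
  have h1 := (Complex.pos_iff.mp (hY.dotProduct_mulVec_pos hw0)).1
  have h2 := (Complex.pos_iff.mp (Matrix.dotProduct_star_self_pos_iff.mpr hw0)).1
  rw [Matrix.neg_mulVec, dotProduct_neg, Complex.neg_re] at hw
  nlinarith

theorem re_nonneg_of_mem_roots_add {A Y : Matrix ι ι ℂ} (hA : Aᴴ = -A) (hY : Y.PosSemidef) {z : ℂ}
    (hz : z ∈ (A + Y).charpoly.roots) : 0 ≤ z.re := by
  obtain ⟨w, hw0, hw⟩ := re_mul_eq_of_mem_roots hA hz
  have h1 := (Complex.nonneg_iff.mp (hY.dotProduct_mulVec_nonneg w)).1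
  have h2 := (Complex.pos_iff.mp (Matrix.dotProduct_star_self_pos_iff.mpr hw0)).1
  nlinarith

theorem numIn_add (s t : Multiset ℂ) (S : Set ℂ) : numIn (s + t) S = numIn s S + numIn t S := by
  classical
  simp [numIn, Multiset.filter_add]

theorem numIn_eq_zero {s : Multiset ℂ} {S : Set ℂ} (h : ∀ z ∈ s, z ∉ S) : numIn s S = 0 := by
  classical
  simpa [numIn, Multiset.filter_eq_nil] using h

theorem numIn_congr {s : Multiset ℂ} {S T : Set ℂ} (h : ∀ z ∈ s, (z ∈ S ↔ z ∈ T)) :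
    numIn s S = numIn s T := by
  classical
  rw [numIn, numIn, Multiset.filter_congr h]

/-- Only the factor `A - Y` of `charpoly_companion` contributes to an open left half-plane. -/
theorem numIn_roots_charpoly_companion {A G Y : Matrix ι ι ℂ} (hA : Aᴴ = -A) (hY : Y.PosSemidef)
    (h : G = Y * Y + A * Y - Y * A) {g : ℝ} (hg : 0 ≤ g) :
    numIn (companion A G).charpoly.roots {z | z.re < -g} =
      numIn (A - Y).charpoly.roots {z | z.re < -g} := by
  rw [charpoly_companion h, Polynomial.roots_mul
    (mul_ne_zero (Matrix.charpoly_monic _).ne_zero (Matrix.charpoly_monic _).ne_zero), numIn_add,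
    numIn_eq_zero (s := (A + Y).charpoly.roots), zero_add]
  intro z hz hzg
  have := re_nonneg_of_mem_roots_add hA hY hz
  simp only [Set.mem_ofPred_eq] at hzg
  linarith

theorem mem_roots_companion {A G Y : Matrix ι ι ℂ} (h : G = Y * Y + A * Y - Y * A) {z : ℂ}
    (hz : z ∈ (A - Y).charpoly.roots) : z ∈ (companion A G).charpoly.roots := by
  rw [charpoly_companion h, Polynomial.roots_mul
    (mul_ne_zero (Matrix.charpoly_monic _).ne_zero (Matrix.charpoly_monic _).ne_zero)]
  exact Multiset.mem_add.mpr (Or.inr hz)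

end Companion

/-! ### Passage to the eigenbasis of `A`. -/

section Coordinates

open scoped InnerProductSpace

variable {n m : ℕ}

theorem inner_toEuclideanLin_conjTranspose {k l : ℕ} (M : Matrix (Fin k) (Fin l) ℂ)
    (x : EuclideanSpace ℂ (Fin k)) (y : EuclideanSpace ℂ (Fin l)) :
    ⟪Matrix.toEuclideanLin Mᴴ x, y⟫_ℂ = ⟪x, Matrix.toEuclideanLin M y⟫_ℂ := by
  rw [Matrix.toEuclideanLin_conjTranspose_eq_adjoint, LinearMap.adjoint_inner_left]

theorem toEuclideanLin_conjTranspose_eq_sum (B : Matrix (Fin n) (Fin m) ℂ)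
    (v : OrthonormalBasis (Fin n) ℂ (EuclideanSpace ℂ (Fin n))) (x : EuclideanSpace ℂ (Fin n)) :
    Matrix.toEuclideanLin Bᴴ x = ∑ j, ⟪v j, x⟫_ℂ • controlVec B (v j) := by
  conv_lhs => rw [← v.sum_repr' x]
  simp [controlVec]

theorem norm_sum_controlVec_sq_le (B : Matrix (Fin n) (Fin m) ℂ)
    (v : OrthonormalBasis (Fin n) ℂ (EuclideanSpace ℂ (Fin n))) (u : Fin n → ℂ) :
    ‖∑ i, u i • controlVec B (v i)‖ ^ 2 ≤ ‖B‖ ^ 2 * ∑ i, ‖u i‖ ^ 2 := by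
  have h1 : ∑ i, u i • controlVec B (v i) = Matrix.toEuclideanLin Bᴴ (∑ i, u i • v i) := by
    simp [controlVec]
  have h2 : ‖∑ i, u i • v i‖ ^ 2 = ∑ i, ‖u i‖ ^ 2 := by
    rw [← v.sum_sq_norm_inner_right]
    refine Finset.sum_congr rfl fun i _ => ?_
    rw [v.orthonormal.inner_right_fintype]
  rw [h1, ← h2, ← mul_pow, ← Matrix.l2_opNorm_conjTranspose]
  gcongr
  exact Matrix.l2_opNorm_mulVec Bᴴ _

theorem isQuadraticEigenvector_of_mulVec {A : Matrix (Fin n) (Fin n) ℂ} (hA : Aᴴ = -A)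
    {lam : Fin n → ℝ} {v : OrthonormalBasis (Fin n) ℂ (EuclideanSpace ℂ (Fin n))}
    (hv : ∀ j, Matrix.toEuclideanLin A (v j) = (Complex.I * (lam j : ℂ)) • v j)
    {B : Matrix (Fin n) (Fin m) ℂ} {z : ℂ} {w : Fin n → ℂ} (hw0 : w ≠ 0)
    (hw : A *ᵥ A *ᵥ w - (2 * z) • A *ᵥ w + z ^ 2 • w = (B * Bᴴ) *ᵥ w) :
    IsQuadraticEigenvector lam (fun j => controlVec B (v j)) z
      (fun j => ⟪v j, WithLp.toLp 2 w⟫_ℂ) := by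
  set x : EuclideanSpace ℂ (Fin n) := WithLp.toLp 2 w with hx
  have hinner : ∀ j y, ⟪v j, Matrix.toEuclideanLin A y⟫_ℂ = Complex.I * lam j * ⟪v j, y⟫_ℂ := by
    intro j y
    rw [← inner_toEuclideanLin_conjTranspose, hA, map_neg, LinearMap.neg_apply, hv, inner_neg_left,
      inner_smul_left]
    simp
  have hvec : Matrix.toEuclideanLin A (Matrix.toEuclideanLin A x)
      - (2 * z) • Matrix.toEuclideanLin A x + z ^ 2 • x =
      Matrix.toEuclideanLin B (Matrix.toEuclideanLin Bᴴ x) := by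
    have := congrArg (WithLp.toLp 2) hw
    rw [← Matrix.mulVec_mulVec] at this
    exact this
  refine ⟨fun h0 => hw0 ?_, fun j => ?_⟩
  · have : x = 0 := by
      rw [← v.sum_repr' x]
      exact Finset.sum_eq_zero fun j _ => by rw [show ⟪v j, x⟫_ℂ = 0 from congrFun h0 j, zero_smul]
    simpa [hx] using this
  · have h1 := congrArg (fun y => ⟪v j, y⟫_ℂ) hvec
    simp only [inner_add_right, inner_sub_right, inner_smul_right, hinner] at h1
    rw [← inner_toEuclideanLin_conjTranspose, toEuclideanLin_conjTranspose_eq_sum B v x] at h1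
    rw [show controlVec B (v j) = Matrix.toEuclideanLin Bᴴ (v j) from rfl, ← h1]
    ring

end Coordinates

/-! ### The smallest singular value and the scalar end of the deformation. -/

section SingularValues

open scoped InnerProductSpace

variable {n m : ℕ}

theorem sigmaMin_sq_mul_norm_sq_le (B : Matrix (Fin n) (Fin m) ℂ) (y : EuclideanSpace ℂ (Fin m)) :
    sigmaMin B ^ 2 * ‖y‖ ^ 2 ≤ ‖Matrix.toEuclideanLin B y‖ ^ 2 := by
  -- For `m = 0` the truncated index `m - 1` is not a valid eigenvalue index, but the space is
  -- trivial.
  rcases Nat.eq_zero_or_pos m with rfl | hm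
  · rw [Subsingleton.elim y 0]
    simp
  set T := Matrix.toEuclideanLin B with hT
  have hS := T.isSymmetric_adjoint_comp_self
  have hfin : Module.finrank ℂ (EuclideanSpace ℂ (Fin m)) = m := finrank_euclideanSpace_fin
  set e := hS.eigenvectorBasis hfin with he
  have hσ : sigmaMin B ^ 2 = hS.eigenvalues hfin ⟨m - 1, Nat.sub_lt hm one_pos⟩ :=
    T.sq_singularValues_of_lt hfin _
  have h1 : ((‖T y‖ ^ 2 : ℝ) : ℂ) = (∑ i, hS.eigenvalues hfin i * ‖⟪e i, y⟫_ℂ‖ ^ 2 : ℝ) := by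
    have h2 : ⟪y, (LinearMap.adjoint T ∘ₗ T) y⟫_ℂ = ⟪T y, T y⟫_ℂ := by
      rw [LinearMap.comp_apply, LinearMap.adjoint_inner_right]
    rw [inner_self_eq_norm_sq_to_K, ← e.sum_inner_mul_inner] at h2
    rw [Complex.ofReal_pow, Complex.ofReal_sum]
    refine h2.symm.trans (Finset.sum_congr rfl fun i _ => ?_)
    rw [← hS, he, hS.apply_eigenvectorBasis, inner_smul_left, ← he, Complex.ofReal_mul,
      ← Complex.normSq_eq_norm_sq, Complex.normSq_eq_conj_mul_self, inner_conj_symm]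
    simp
    ring
  rw [Complex.ofReal_inj] at h1
  rw [h1, hσ, ← e.sum_sq_norm_inner_right y, Finset.mul_sum]
  refine Finset.sum_le_sum fun i _ => ?_
  gcongr
  exact hS.eigenvalues_antitone hfin (Fin.mk_le_mk.mpr (Nat.le_sub_one_of_lt i.isLt))

theorem sigmaMin_nonneg (B : Matrix (Fin n) (Fin m) ℂ) : 0 ≤ sigmaMin B :=
  LinearMap.singularValues_nonneg _ _

theorem sigmaMin_sq_mul_norm_sq_le_of_mem_range (B : Matrix (Fin n) (Fin m) ℂ)
    {p : EuclideanSpace ℂ (Fin n)} (hp : p ∈ LinearMap.range (Matrix.toEuclideanLin B)) :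
    sigmaMin B ^ 2 * ‖p‖ ^ 2 ≤ ‖Matrix.toEuclideanLin Bᴴ p‖ ^ 2 := by
  obtain ⟨y, rfl⟩ := hp
  have hσ := sigmaMin_nonneg B
  set p := Matrix.toEuclideanLin B y with hp
  have h1 : sigmaMin B * ‖y‖ ≤ ‖p‖ := by
    have := sigmaMin_sq_mul_norm_sq_le B y
    rw [← mul_pow] at this
    exact (pow_le_pow_iff_left₀ (by positivity) (norm_nonneg _) two_ne_zero).mp this
  have h2 : ‖p‖ ^ 2 ≤ ‖Matrix.toEuclideanLin Bᴴ p‖ * ‖y‖ := by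
    have h3 := norm_inner_le_norm (𝕜 := ℂ) (Matrix.toEuclideanLin Bᴴ p) y
    rw [inner_toEuclideanLin_conjTranspose, ← hp, inner_self_eq_norm_sq_to_K] at h3
    simpa using h3
  rcases (norm_nonneg p).eq_or_lt with h | h
  · rw [← h]; simp
  · have h4 : sigmaMin B * ‖p‖ ≤ ‖Matrix.toEuclideanLin Bᴴ p‖ := by
      refine le_of_mul_le_mul_right ?_ h
      calc sigmaMin B * ‖p‖ * ‖p‖ = sigmaMin B * ‖p‖ ^ 2 := by ring
        _ ≤ sigmaMin B * (‖Matrix.toEuclideanLin Bᴴ p‖ * ‖y‖) := by gcongr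
        _ = ‖Matrix.toEuclideanLin Bᴴ p‖ * (sigmaMin B * ‖y‖) := by ring
        _ ≤ ‖Matrix.toEuclideanLin Bᴴ p‖ * ‖p‖ := by gcongr
    rw [← mul_pow]
    gcongr

theorem rank_mul_conjTranspose_of_sigmaMin_pos {B : Matrix (Fin n) (Fin m) ℂ}
    (hσ : 0 < sigmaMin B) : (B * Bᴴ).rank = m := by
  rw [Matrix.rank_self_mul_conjTranspose, Matrix.rank_eq_finrank_range_toLin B
    (EuclideanSpace.basisFun (Fin n) ℂ).toBasis (EuclideanSpace.basisFun (Fin m) ℂ).toBasis,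
    ← Matrix.toEuclideanLin_eq_toLin_orthonormal, LinearMap.finrank_range_of_inj,
    finrank_euclideanSpace_fin]
  refine (injective_iff_map_eq_zero _).mpr fun y hy => ?_
  have h1 := sigmaMin_sq_mul_norm_sq_le B y
  rw [hy, norm_zero] at h1
  have h2 : 0 < sigmaMin B ^ 2 := by positivity
  have h3 : ‖y‖ ^ 2 ≤ 0 := by nlinarith
  exact norm_eq_zero.mp (pow_eq_zero_iff two_ne_zero |>.mp (le_antisymm h3 (by positivity)))

/-- An eigenvector of `B Bᴴ` for a nonzero eigenvalue lies in the range of `B`, where `Bᴴ` is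
bounded below by `σ_m`. -/
theorem sigmaMin_sq_le_eigenvalue {B : Matrix (Fin n) (Fin m) ℂ} {μ : ℝ} (hμ : μ ≠ 0)
    {u : EuclideanSpace ℂ (Fin n)} (hu : u ≠ 0)
    (h : Matrix.toEuclideanLin B (Matrix.toEuclideanLin Bᴴ u) = (μ : ℂ) • u) :
    sigmaMin B ^ 2 ≤ μ := by
  have hμ' : (μ : ℂ) ≠ 0 := by exact_mod_cast hμ
  have hmem : u ∈ LinearMap.range (Matrix.toEuclideanLin B) :=
    ⟨(μ : ℂ)⁻¹ • Matrix.toEuclideanLin Bᴴ u, by rw [map_smul, h, smul_smul, inv_mul_cancel₀ hμ',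
      one_smul]⟩
  have h1 := sigmaMin_sq_mul_norm_sq_le_of_mem_range B hmem
  have h2 : ((‖Matrix.toEuclideanLin Bᴴ u‖ ^ 2 : ℝ) : ℂ) = (μ * ‖u‖ ^ 2 : ℝ) := by
    have h3 := inner_toEuclideanLin_conjTranspose B u (Matrix.toEuclideanLin Bᴴ u)
    rw [h, inner_smul_right, inner_self_eq_norm_sq_to_K, inner_self_eq_norm_sq_to_K] at h3
    push_cast
    exact h3
  rw [Complex.ofReal_inj.mp h2] at h1
  have h4 := norm_pos_iff.mpr hu
  exact le_of_mul_le_mul_right h1 (by positivity)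

/-- For a skew-Hermitian scalar matrix in place of `A`, the square root of `B Bᴴ` takes the role of
`X⁻¹`, and the eigenvalues are explicit. -/
theorem exists_sqrt_numIn_eq {B : Matrix (Fin n) (Fin m) ℂ} {g : ℝ} (hg : 0 ≤ g)
    (hgσ : g < sigmaMin B) (c : ℂ) (hc : c.re = 0) :
    ∃ S : Matrix (Fin n) (Fin n) ℂ, S.PosSemidef ∧ S * S = B * Bᴴ ∧
      numIn (c • (1 : Matrix (Fin n) (Fin n) ℂ) - S).charpoly.roots {z | z.re < -g} = m := by
  classical
  have hG : (B * Bᴴ).PosSemidef := Matrix.posSemidef_self_mul_conjTranspose B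
  set μ := hG.isHermitian.eigenvalues with hμ
  set U : Matrix (Fin n) (Fin n) ℂ := hG.isHermitian.eigenvectorUnitary.val with hU
  have hUU : U * Uᴴ = 1 := Unitary.coe_mul_star_self hG.isHermitian.eigenvectorUnitary
  have hUU' : Uᴴ * U = 1 := Unitary.coe_star_mul_self hG.isHermitian.eigenvectorUnitary
  have hspec : B * Bᴴ = U * Matrix.diagonal (fun i => (μ i : ℂ)) * Uᴴ := by
    conv_lhs => rw [hG.isHermitian.spectral_theorem, Unitary.conjStarAlgAut_apply]
    rfl
  have hμ0 : ∀ i, 0 ≤ μ i := hG.eigenvalues_nonneg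
  have hμσ : ∀ i, μ i ≠ 0 → sigmaMin B ^ 2 ≤ μ i := fun i hi => by
    refine sigmaMin_sq_le_eigenvalue hi (u := hG.isHermitian.eigenvectorBasis i)
      (hG.isHermitian.eigenvectorBasis.orthonormal.ne_zero i) ?_
    have h1 := congrArg (WithLp.toLp 2) (hG.isHermitian.mulVec_eigenvectorBasis i)
    rw [← Matrix.mulVec_mulVec] at h1
    exact h1
  refine ⟨U * Matrix.diagonal (fun i => (√(μ i) : ℂ)) * Uᴴ, ?_, ?_, ?_⟩
  · refine Matrix.PosSemidef.mul_mul_conjTranspose_same (Matrix.PosSemidef.diagonal fun i => ?_) U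
    simp only [Pi.zero_apply]
    exact_mod_cast Real.sqrt_nonneg _
  · rw [hspec]
    calc U * Matrix.diagonal (fun i => (√(μ i) : ℂ)) * Uᴴ *
          (U * Matrix.diagonal (fun i => (√(μ i) : ℂ)) * Uᴴ)
        = U * Matrix.diagonal (fun i => (√(μ i) : ℂ)) * (Uᴴ * U) *
          Matrix.diagonal (fun i => (√(μ i) : ℂ)) * Uᴴ := by simp only [Matrix.mul_assoc]
      _ = _ := by
        rw [hUU', Matrix.mul_one, Matrix.mul_assoc U, Matrix.diagonal_mul_diagonal]
        congr 3
        ext i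
        rw [← Complex.ofReal_mul, Real.mul_self_sqrt (hμ0 i)]
  · have h1 : c • (1 : Matrix (Fin n) (Fin n) ℂ) - U * Matrix.diagonal (fun i => (√(μ i) : ℂ)) * Uᴴ
        = U * (Matrix.diagonal (fun i => c - (√(μ i) : ℂ)) * Uᴴ) := by
      have h2 : Matrix.diagonal (fun i => c - (√(μ i) : ℂ)) =
          c • (1 : Matrix (Fin n) (Fin n) ℂ) - Matrix.diagonal (fun i => (√(μ i) : ℂ)) := by
        rw [Matrix.smul_one_eq_diagonal, Matrix.diagonal_sub]
      rw [h2, Matrix.sub_mul, Matrix.mul_sub, Matrix.smul_mul, Matrix.one_mul, Matrix.mul_smul, hUU,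
        Matrix.mul_assoc]
    rw [h1, Matrix.charpoly_mul_comm, Matrix.mul_assoc, hUU', Matrix.mul_one,
      Matrix.charpoly_diagonal, Polynomial.roots_prod _ _ (Finset.prod_ne_zero_iff.mpr
        fun i _ => Polynomial.X_sub_C_ne_zero _)]
    simp only [Polynomial.roots_X_sub_C, Multiset.bind_singleton]
    -- The eigenvalues are `c - √μ_i`. Those with `μ_i ≠ 0` have `√μ_i ≥ σ_m > g`, and there are
    -- `rank (B Bᴴ) = m` of them.
    rw [numIn, Multiset.filter_map, Multiset.card_map, ← Finset.filter_val, ← Finset.card_def,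
      ← rank_mul_conjTranspose_of_sigmaMin_pos (hg.trans_lt hgσ),
      hG.isHermitian.rank_eq_card_non_zero_eigs, Fintype.card_subtype]
    congr 1
    refine Finset.filter_congr fun i _ => ?_
    simp only [Function.comp_apply, Set.mem_ofPred_eq, Complex.sub_re, hc, Complex.ofReal_re,
      zero_sub, neg_lt_neg_iff]
    constructor
    · intro h h0
      rw [← hμ] at h0
      rw [h0, Real.sqrt_zero] at h
      linarith
    · intro h
      exact hgσ.trans_le (Real.le_sqrt_of_sq_le (hμσ i h))

end SingularValues

/-! ### The spectral gap and the count to its left. -/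

open scoped InnerProductSpace

variable {n m : ℕ}

theorem numIn_add_numIn_compl (s : Multiset ℂ) (S : Set ℂ) : numIn s S + numIn s Sᶜ = s.card := by
  classical
  simp only [numIn, Set.mem_compl_iff]
  rw [← Multiset.card_add, Multiset.filter_add_not]

theorem exists_isQuadraticEigenvector {A : Matrix (Fin n) (Fin n) ℂ} (hA : Aᴴ = -A)
    {lam : Fin n → ℝ} {v : OrthonormalBasis (Fin n) ℂ (EuclideanSpace ℂ (Fin n))}
    (hv : ∀ j, Matrix.toEuclideanLin A (v j) = (Complex.I * (lam j : ℂ)) • v j)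
    {B : Matrix (Fin n) (Fin m) ℂ} {z : ℂ} (hz : z ∈ (companion A (B * Bᴴ)).charpoly.roots) :
    ∃ x : EuclideanSpace ℂ (Fin n),
      IsQuadraticEigenvector lam (fun j => controlVec B (v j)) z (fun j => ⟪v j, x⟫_ℂ) := by
  obtain ⟨w, hw0, hw⟩ := exists_quadratic_eigenvector hz
  exact ⟨_, isQuadraticEigenvector_of_mulVec hA hv hw0 hw⟩

/-- Applies `gap` to the orthogonal splitting of the eigenvector along the range of `B` and its
complement, the kernel of `Bᴴ`. -/
theorem le_re_sq_of_isQuadraticEigenvector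
    {lam : Fin n → ℝ} {v : OrthonormalBasis (Fin n) ℂ (EuclideanSpace ℂ (Fin n))}
    {B : Matrix (Fin n) (Fin m) ℂ} {z : ℂ} {x : EuclideanSpace ℂ (Fin n)}
    (h : IsQuadraticEigenvector lam (fun j => controlVec B (v j)) z (fun j => ⟪v j, x⟫_ℂ))
    (hz : z.re < 0) {lo hi : ℝ} (hlam : ∀ j, lam j ∈ Set.Icc lo hi) (hσ : 0 < sigmaMin B)
    (hlow : 3 * (hi - lo) ^ 2 ≤ z.re ^ 2) : 3 / 8 * sigmaMin B ^ 2 ≤ z.re ^ 2 := by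
  obtain ⟨p, hp, q, hq, hx⟩ :=
    (LinearMap.range (Matrix.toEuclideanLin B)).exists_add_mem_mem_orthogonal x
  have hBq : Matrix.toEuclideanLin Bᴴ q = 0 := by
    refine ext_inner_right ℂ fun y => ?_
    rw [inner_toEuclideanLin_conjTranspose, inner_zero_left]
    exact (Submodule.mem_orthogonal' _ _).mp hq _ ⟨y, rfl⟩
  refine h.gap hz hσ hlam (p := fun j => ⟪v j, p⟫_ℂ) (q := fun j => ⟪v j, q⟫_ℂ) ?_ ?_ ?_ ?_ hlow
  · funext j
    simp [hx]
  · rw [← toEuclideanLin_conjTranspose_eq_sum, hBq]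
  · simp only [inner_conj_symm]
    rw [v.sum_inner_mul_inner]
    exact (Submodule.mem_orthogonal' _ _).mp hq _ hp
  · rw [← toEuclideanLin_conjTranspose_eq_sum, hx, map_add, hBq, add_zero,
      v.sum_sq_norm_inner_right]
    exact sigmaMin_sq_mul_norm_sq_le_of_mem_range B hp

/-- The segment from the scalar matrix `i lo` to `A`. -/
noncomputable def skewSegment (A : Matrix (Fin n) (Fin n) ℂ) (lo t : ℝ) :
    Matrix (Fin n) (Fin n) ℂ :=
  (((1 - t : ℝ) : ℂ) * (Complex.I * lo)) • 1 + (t : ℂ) • A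

theorem conjTranspose_skewSegment {A : Matrix (Fin n) (Fin n) ℂ} (hA : Aᴴ = -A) (lo t : ℝ) :
    (skewSegment A lo t)ᴴ = -skewSegment A lo t := by
  simp only [skewSegment, Matrix.conjTranspose_add, Matrix.conjTranspose_smul,
    Matrix.conjTranspose_one, hA, Complex.star_def, map_mul, Complex.conj_ofReal, Complex.conj_I]
  module

theorem toEuclideanLin_skewSegment {A : Matrix (Fin n) (Fin n) ℂ} {μ : ℝ}
    {x : EuclideanSpace ℂ (Fin n)}
    (h : Matrix.toEuclideanLin A x = (Complex.I * (μ : ℂ)) • x) (lo t : ℝ) :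
    Matrix.toEuclideanLin (skewSegment A lo t) x =
      (Complex.I * (((1 - t) * lo + t * μ : ℝ) : ℂ)) • x := by
  have h1 : Matrix.toEuclideanLin (1 : Matrix (Fin n) (Fin n) ℂ) x = x := by
    simp
  rw [skewSegment, map_add, map_smul, map_smul, LinearMap.add_apply, LinearMap.smul_apply,
    LinearMap.smul_apply, h, h1]
  push_cast
  module

theorem continuous_companion_skewSegment (A G : Matrix (Fin n) (Fin n) ℂ) (lo : ℝ) :
    Continuous fun t : unitInterval => companion (skewSegment A lo t) G := by
  have h : Continuous fun t : unitInterval => skewSegment A lo t := by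
    unfold skewSegment
    fun_prop
  exact h.matrix_fromBlocks continuous_const continuous_const h

/-- The number of closed-loop eigenvalues to the left of a line in the spectral gap. -/
theorem numIn_closedLoopEigenvalues {A : Matrix (Fin n) (Fin n) ℂ} (hA : Aᴴ = -A)
    {B : Matrix (Fin n) (Fin m) ℂ} {lam : Fin n → ℝ}
    {v : OrthonormalBasis (Fin n) ℂ (EuclideanSpace ℂ (Fin n))}
    (hv : ∀ j, Matrix.toEuclideanLin A (v j) = (Complex.I * (lam j : ℂ)) • v j)
    {X : Matrix (Fin n) (Fin n) ℂ} (hX : IsRiccatiSolution A B X) {lo hi g : ℝ}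
    (hlam : ∀ j, lam j ∈ Set.Icc lo hi) (hg : 0 < g) (hg1 : 3 * (hi - lo) ^ 2 ≤ g ^ 2)
    (hg2 : g ^ 2 < 3 / 8 * sigmaMin B ^ 2) :
    numIn (closedLoopEigenvalues A B X) {z | z.re < -g} = m := by
  have hσ0 := sigmaMin_nonneg B
  have hgσ : g < sigmaMin B := by nlinarith
  -- The spectrum of `skewSegment A lo t` stays in `i [lo, hi]`, so the gap estimate keeps the line
  -- `Re z = -g` free of eigenvalues along the whole path.
  have hroot : ∀ t : unitInterval, ∀ z ∈ (companion (skewSegment A lo t) (B * Bᴴ)).charpoly.roots,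
      z ∈ {z : ℂ | z.re < -g} ∪ {z : ℂ | -g < z.re} := by
    intro t z hz
    obtain ⟨x, hx⟩ := exists_isQuadraticEigenvector (conjTranspose_skewSegment hA lo t)
      (fun j => toEuclideanLin_skewSegment (hv j) lo t) hz
    refine lt_or_gt_of_ne (a := z.re) (b := -g) fun hre => ?_
    have hre2 : z.re ^ 2 = g ^ 2 := by rw [hre]; ring
    have hlamt : ∀ j, (1 - (t : ℝ)) * lo + t * lam j ∈ Set.Icc lo hi := fun j => by
      have h0 := t.2.1
      have h1 := t.2.2
      have := (hlam j).1
      have := (hlam j).2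
      constructor <;> nlinarith
    have := le_re_sq_of_isQuadraticEigenvector hx (by linarith) hlamt (hg.trans hgσ)
      (by rw [hre2]; exact hg1)
    linarith
  have hU : IsOpen {z : ℂ | z.re < -g} := isOpen_lt Complex.continuous_re continuous_const
  have hV : IsOpen {z : ℂ | -g < z.re} := isOpen_lt continuous_const Complex.continuous_re
  have hUV : Disjoint {z : ℂ | z.re < -g} {z : ℂ | -g < z.re} :=
    Set.disjoint_left.mpr fun z h1 h2 => lt_asymm (show z.re < -g from h1) h2
  have hcount := numIn_roots_charpoly_eq_of_continuous
    (continuous_companion_skewSegment A (B * Bᴴ) lo) hU hV hUV hroot 1 0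
  -- A scalar matrix commutes with `S`, so `S² = B Bᴴ` is already the relation needed to factor the
  -- companion polynomial at `t = 0`; at `t = 1` that role is played by `X⁻¹`.
  obtain ⟨S, hS, hSS, hSm⟩ := exists_sqrt_numIn_eq hg.le hgσ (Complex.I * lo) (by simp)
  have h1 : skewSegment A lo ((1 : unitInterval) : ℝ) = A := by simp [skewSegment]
  have h0 : skewSegment A lo ((0 : unitInterval) : ℝ) = (Complex.I * lo) • 1 := by
    simp [skewSegment]
  have hskew0 := conjTranspose_skewSegment hA lo ((0 : unitInterval) : ℝ)
  rw [h1, h0, numIn_roots_charpoly_companion hA hX.posDef.inv.posSemidef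
      (hX.mul_conjTranspose_eq hA) hg.le,
    numIn_roots_charpoly_companion (Y := S) (h0 ▸ hskew0) hS (by
      rw [hSS, Matrix.smul_mul, Matrix.one_mul, Matrix.mul_smul, Matrix.mul_one]; abel) hg.le,
    hSm] at hcount
  rw [closedLoopEigenvalues, hX.charpoly_closedLoop hA, hcount]

/-! ### Excluded triangles and disks. -/

theorem sep_nonneg (lam : Fin n → ℝ) (k : Fin n) : 0 ≤ sep lam k :=
  Real.iInf_nonneg fun _ => abs_nonneg _

theorem sep_le (lam : Fin n → ℝ) {j k : Fin n} (hj : j ≠ k) : sep lam k ≤ |lam j - lam k| :=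
  ciInf_le (f := fun j : {j : Fin n // j ≠ k} => |lam j - lam k|) (Set.finite_range _).bddBelow
    ⟨j, hj⟩

theorem notMem_triangle {a b : ℝ} (hab : a ≤ b) {z : ℂ} (h : z.im - a < -z.re ∨ b - z.im < -z.re) :
    z ∉ triangle a b := by
  intro hz
  have hconv : Convex ℝ {z : ℂ | -z.re ≤ z.im - a ∧ -z.re ≤ b - z.im} := by
    intro x hx y hy s t hs ht hst
    obtain rfl : t = 1 - s := by linarith
    obtain ⟨hx1, hx2⟩ := hx
    obtain ⟨hy1, hy2⟩ := hy
    simp only [Set.mem_ofPred_eq, Complex.add_re, Complex.add_im, Complex.real_smul,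
      Complex.re_ofReal_mul, Complex.im_ofReal_mul]
    constructor <;> nlinarith
  have h1 := convexHull_min (t := {z : ℂ | -z.re ≤ z.im - a ∧ -z.re ≤ b - z.im}) (fun x hx => by
    rcases hx with rfl | rfl | rfl <;> constructor <;> dsimp only <;> linarith) hconv hz
  rcases h with h | h
  · exact absurd h1.1 (not_le.mpr h)
  · exact absurd h1.2 (not_le.mpr h)

theorem radius_le_radiusOne {b β δ : ℝ} (hb : 0 ≤ b) : radius b β δ ≤ radiusOne b β δ := by
  unfold radius radiusOne
  split_ifs
  · exact le_rfl
  · have h1 : 1 ≤ 1 + 2 * (β ^ 2 / δ ^ 2) := by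
      have : 0 ≤ β ^ 2 / δ ^ 2 := by positivity
      linarith
    gcongr
    exact Real.sqrt_le_left (by linarith) |>.mpr (by nlinarith)

theorem norm_inner_eq_mul_norm_fin_one (x y : EuclideanSpace ℂ (Fin 1)) :
    ‖⟪x, y⟫_ℂ‖ = ‖x‖ * ‖y‖ := by
  simp [EuclideanSpace.norm_eq, PiLp.inner_apply]
  ring

theorem norm_controlVec_le (B : Matrix (Fin n) (Fin m) ℂ)
    (v : OrthonormalBasis (Fin n) ℂ (EuclideanSpace ℂ (Fin n))) (k : Fin n) :
    ‖controlVec B (v k)‖ ≤ ‖B‖ := by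
  have := Matrix.l2_opNorm_mulVec Bᴴ (v k)
  rw [Matrix.l2_opNorm_conjTranspose, v.orthonormal.1 k, mul_one] at this
  exact this

/-- Inside the disk of radius `radiusOne`, the bounds on the dominant component hold. -/
theorem disk_bounds {lam : Fin n → ℝ} {v : OrthonormalBasis (Fin n) ℂ (EuclideanSpace ℂ (Fin n))}
    {B : Matrix (Fin n) (Fin m) ℂ} {z : ℂ} {w : Fin n → ℂ}
    (h : IsQuadraticEigenvector lam (fun j => controlVec B (v j)) z w) (hz : z.re < 0) {k : Fin n}
    (hball : ‖Complex.I * lam k - z‖ ≤ radiusOne ‖controlVec B (v k)‖ ‖B‖ (sep lam k)) :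
    0 < sep lam k ∧ 0 < ‖controlVec B (v k)‖ ∧
    ‖∑ i, w i • controlVec B (v i)‖ ≤ -z.re * ‖w k‖ ∧
      ‖w k‖ * ‖controlVec B (v k)‖ <
        (1 + 2 * (‖B‖ ^ 2 / sep lam k ^ 2)) * ‖∑ i, w i • controlVec B (v i)‖ := by
  have hnorm := norm_sq_I_mul_sub (lam k) z
  have hpos : 0 < ‖Complex.I * lam k - z‖ := by
    refine norm_pos_iff.mpr fun h0 => ?_
    rw [h0, norm_zero] at hnorm
    nlinarith [sq_nonneg (lam k - z.im), sq_pos_of_neg hz]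
  have hδ : 0 < sep lam k := by
    refine (sep_nonneg lam k).lt_of_ne fun h0 => ?_
    rw [radiusOne, if_pos h0.symm] at hball
    linarith
  rw [radiusOne, if_neg hδ.ne'] at hball
  have hb : 0 < ‖controlVec B (v k)‖ := by
    refine (norm_nonneg _).lt_of_ne fun h0 => ?_
    rw [← h0, zero_div] at hball
    linarith
  have hbB := norm_controlVec_le B v k
  have hβ : 0 < ‖B‖ := hb.trans_le hbB
  refine ⟨hδ, hb, h.component_bounds hz hβ (norm_sum_controlVec_sq_le B v) hδ
    (fun j hj => sep_le lam hj) ?_⟩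
  -- Since `‖b_k‖ ≤ ‖B‖`, dropping the `1` in the denominator shows that the disk has radius at most
  -- `δ / √2`, as `component_bounds` requires.
  rw [← hnorm]
  calc ‖Complex.I * lam k - z‖ ^ 2
      ≤ (‖controlVec B (v k)‖ / √(1 + 2 * (‖B‖ ^ 2 / sep lam k ^ 2))) ^ 2 := by gcongr
    _ = ‖controlVec B (v k)‖ ^ 2 / (1 + 2 * (‖B‖ ^ 2 / sep lam k ^ 2)) := by
      rw [div_pow, Real.sq_sqrt (by positivity)]
    _ ≤ ‖B‖ ^ 2 / (2 * (‖B‖ ^ 2 / sep lam k ^ 2)) := by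
      gcongr
      linarith
    _ = sep lam k ^ 2 / 2 := by field_simp

/-- With `r = |iλ_k - ν|` and `K = 1 + 2‖B‖²/δ_k²`, the dominant-component bounds chain to `‖w_k‖
‖b_k‖ < K ‖f‖ ≤ K r ‖w_k‖`, impossible when `K r ≤ ‖b_k‖`. -/
theorem notMem_closedBall_radius {lam : Fin n → ℝ}
    {v : OrthonormalBasis (Fin n) ℂ (EuclideanSpace ℂ (Fin n))}
    {B : Matrix (Fin n) (Fin m) ℂ} {z : ℂ} {w : Fin n → ℂ}
    (h : IsQuadraticEigenvector lam (fun j => controlVec B (v j)) z w) (hz : z.re < 0)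
    (k : Fin n) : z ∉ Metric.closedBall (Complex.I * (lam k : ℂ))
      (radius ‖controlVec B (v k)‖ ‖B‖ (sep lam k)) := by
  rw [Metric.mem_closedBall, dist_comm, dist_eq_norm]
  intro hball
  obtain ⟨hδ, hb, h1, h2⟩ := disk_bounds h hz (hball.trans (radius_le_radiusOne (norm_nonneg _)))
  rw [radius, if_neg hδ.ne', le_div_iff₀ (by positivity)] at hball
  have h3 : -z.re ≤ ‖Complex.I * lam k - z‖ := by
    refine abs_le_of_sq_le_sq' ?_ (norm_nonneg _) |>.2
    rw [norm_sq_I_mul_sub]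
    nlinarith [sq_nonneg (lam k - z.im)]
  set K := 1 + 2 * (‖B‖ ^ 2 / sep lam k ^ 2) with hK
  have hK0 : 0 < K := by positivity
  have h4 : ‖w k‖ * ‖controlVec B (v k)‖ < ‖w k‖ * ‖controlVec B (v k)‖ :=
    calc ‖w k‖ * ‖controlVec B (v k)‖ < K * ‖∑ i, w i • controlVec B (v i)‖ := h2
      _ ≤ K * (-z.re * ‖w k‖) := by gcongr
      _ ≤ K * (‖Complex.I * lam k - z‖ * ‖w k‖) := by gcongr
      _ = ‖w k‖ * (‖Complex.I * lam k - z‖ * K) := by ring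
      _ ≤ _ := by gcongr
  exact lt_irrefl _ h4

/-- In a one-dimensional control space Cauchy–Schwarz is an equality, so the `k`-th equation gives
`r² ‖w_k‖ = ‖b_k‖ ‖f‖` exactly. This replaces `‖f‖ ≤ r ‖w_k‖`, and only `K r² ≤ ‖b_k‖²` is needed
for the contradiction. -/
theorem notMem_closedBall_radiusOne {lam : Fin n → ℝ}
    {v : OrthonormalBasis (Fin n) ℂ (EuclideanSpace ℂ (Fin n))}
    {B : Matrix (Fin n) (Fin 1) ℂ} {z : ℂ} {w : Fin n → ℂ}
    (h : IsQuadraticEigenvector lam (fun j => controlVec B (v j)) z w) (hz : z.re < 0)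
    (k : Fin n) : z ∉ Metric.closedBall (Complex.I * (lam k : ℂ))
      (radiusOne ‖controlVec B (v k)‖ ‖B‖ (sep lam k)) := by
  rw [Metric.mem_closedBall, dist_comm, dist_eq_norm]
  intro hball
  obtain ⟨hδ, hb, -, h2⟩ := disk_bounds h hz hball
  rw [radiusOne, if_neg hδ.ne'] at hball
  set K := 1 + 2 * (‖B‖ ^ 2 / sep lam k ^ 2) with hK
  have hK0 : 0 < K := by positivity
  have h3 : ‖Complex.I * lam k - z‖ ^ 2 * K ≤ ‖controlVec B (v k)‖ ^ 2 := by
    rw [← le_div_iff₀ hK0]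
    calc ‖Complex.I * lam k - z‖ ^ 2 ≤ (‖controlVec B (v k)‖ / √K) ^ 2 := by gcongr
      _ = _ := by rw [div_pow, Real.sq_sqrt hK0.le]
  have h4 := h.sq_mul_norm_eq k
  rw [norm_inner_eq_mul_norm_fin_one, ← norm_sq_I_mul_sub] at h4
  have h5 : ‖w k‖ * ‖controlVec B (v k)‖ ^ 2 < ‖w k‖ * ‖controlVec B (v k)‖ ^ 2 :=
    calc ‖w k‖ * ‖controlVec B (v k)‖ ^ 2
        = ‖controlVec B (v k)‖ * (‖w k‖ * ‖controlVec B (v k)‖) := by ring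
      _ < ‖controlVec B (v k)‖ * (K * ‖∑ i, w i • controlVec B (v i)‖) := by gcongr
      _ = ‖w k‖ * (‖Complex.I * lam k - z‖ ^ 2 * K) := by linear_combination (-K) * h4
      _ ≤ _ := by gcongr
  exact lt_irrefl _ h5

end LQR

/-! ### Assembly of the three statements. -/

theorem theorem2 (n m : ℕ) (hn : 0 < n)
    (A : Matrix (Fin n) (Fin n) ℂ) (hA : Aᴴ = -A)
    (B : Matrix (Fin n) (Fin m) ℂ)
    (lam : Fin n → ℝ) (hlam : Monotone lam)
    (v : OrthonormalBasis (Fin n) ℂ (EuclideanSpace ℂ (Fin n)))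
    (hv : ∀ j, Matrix.toEuclideanLin A (v j) = (Complex.I * (lam j : ℂ)) • v j)
    (X : Matrix (Fin n) (Fin n) ℂ) (hX : LQR.IsRiccatiSolution A B X)
    (lamMin lamMax Δ : ℝ)
    (hmin : lamMin = lam ⟨0, hn⟩) (hmax : lamMax = lam ⟨n - 1, Nat.sub_lt hn one_pos⟩)
    (hΔ : Δ = lamMax - lamMin) :
    -- location of every closed-loop eigenvalue
    (∀ ν ∈ LQR.closedLoopEigenvalues A B X,
      ν ∈ Set.Ico (-‖B‖) 0 ×ℂ Set.Icc lamMin lamMax ∧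
      (∀ (k : ℕ) (hk : k + 1 < n),
        ν ∉ LQR.triangle (lam ⟨k, Nat.lt_of_succ_lt hk⟩) (lam ⟨k + 1, hk⟩)) ∧
      (2 ≤ n → ∀ k : Fin n,
        ν ∉ Metric.closedBall (Complex.I * (lam k : ℂ))
          (LQR.radius ‖LQR.controlVec B (v k)‖ ‖B‖ (LQR.sep lam k)))) ∧
    -- separation into two groups, counted with multiplicity
    (m ≤ n → 2 * √2 * Δ < LQR.sigmaMin B →
      LQR.numIn (LQR.closedLoopEigenvalues A B X)
        (Set.Icc (-‖B‖) (-(√6 / 4 * LQR.sigmaMin B)) ×ℂ Set.Icc lamMin lamMax) = m ∧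
      LQR.numIn (LQR.closedLoopEigenvalues A B X)
        (Set.Ioo (-(√3 * Δ)) 0 ×ℂ Set.Icc lamMin lamMax) = n - m ∧
      ∀ ν ∈ LQR.closedLoopEigenvalues A B X,
        ν ∉ Set.Icc (-‖B‖) (-(√6 / 4 * LQR.sigmaMin B)) ×ℂ Set.Icc lamMin lamMax →
        ν ∈ Set.Ioo (-(√3 * Δ)) 0 ×ℂ Set.Icc lamMin lamMax) ∧
    -- larger disks for a one-dimensional control
    (m = 1 → 2 ≤ n → ∀ ν ∈ LQR.closedLoopEigenvalues A B X, ∀ k : Fin n,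
      ν ∉ Metric.closedBall (Complex.I * (lam k : ℂ))
        (LQR.radiusOne ‖LQR.controlVec B (v k)‖ ‖B‖ (LQR.sep lam k))) := by

  have hlam' : ∀ j, lam j ∈ Set.Icc lamMin lamMax := fun j => by
    rw [hmin, hmax]
    exact ⟨hlam (Fin.mk_le_mk.mpr (Nat.zero_le _)),
      hlam (Fin.mk_le_mk.mpr (Nat.le_sub_one_of_lt j.isLt))⟩
  have hneg : ∀ ν ∈ LQR.closedLoopEigenvalues A B X, ν.re < 0 := fun ν hν => by
    rw [LQR.closedLoopEigenvalues, hX.charpoly_closedLoop hA] at hν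
    exact LQR.re_neg_of_mem_roots_sub hA hX.posDef.inv hν
  have heig : ∀ ν ∈ LQR.closedLoopEigenvalues A B X, ∃ x : EuclideanSpace ℂ (Fin n),
      LQR.IsQuadraticEigenvector lam (fun j => LQR.controlVec B (v j)) ν
        (fun j => inner ℂ (v j) x) := fun ν hν => by
    rw [LQR.closedLoopEigenvalues, hX.charpoly_closedLoop hA] at hν
    exact LQR.exists_isQuadraticEigenvector hA hv
      (LQR.mem_roots_companion (hX.mul_conjTranspose_eq hA) hν)
  have hbox : ∀ ν ∈ LQR.closedLoopEigenvalues A B X,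
      -‖B‖ ≤ ν.re ∧ ν.im ∈ Set.Icc lamMin lamMax := fun ν hν => by
    obtain ⟨x, hx⟩ := heig ν hν
    exact ⟨(abs_le.mp (hx.abs_re_le (norm_nonneg _) (LQR.norm_sum_controlVec_sq_le B v))).1,
      hx.im_mem_Icc (hneg ν hν).ne hlam'⟩
  refine ⟨fun ν hν => ?_, fun hmn hgap => ?_, fun hm1 _ ν hν k => ?_⟩
  · obtain ⟨x, hx⟩ := heig ν hν
    refine ⟨⟨⟨(hbox ν hν).1, hneg ν hν⟩, (hbox ν hν).2⟩, fun k hk => ?_,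
      fun _ k => LQR.notMem_closedBall_radius hx (hneg ν hν) k⟩
    obtain ⟨j, hj⟩ := hx.exists_abs_sub_lt (hneg ν hν).ne
    rw [abs_of_neg (hneg ν hν), abs_lt] at hj
    refine LQR.notMem_triangle (hlam (Fin.mk_le_mk.mpr (Nat.le_succ k))) ?_
    rcases Nat.lt_or_ge k j.val with hkj | hkj
    · right
      have : lam ⟨k + 1, hk⟩ ≤ lam j := hlam (Fin.mk_le_mk.mpr hkj)
      linarith [hj.2]
    · left
      have : lam j ≤ lam ⟨k, Nat.lt_of_succ_lt hk⟩ := hlam (Fin.mk_le_mk.mpr hkj)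
      linarith [hj.1]
  · have hΔ0 : 0 ≤ Δ := by
      rw [hΔ]
      linarith [(hlam' ⟨0, hn⟩).1, (hlam' ⟨0, hn⟩).2]
    set σ := LQR.sigmaMin B with hσdef
    have hσ : 0 < σ := lt_of_le_of_lt (by positivity) hgap
    have h3 : √3 ^ 2 = 3 := Real.sq_sqrt (by norm_num)
    have h6 : √6 ^ 2 = 6 := Real.sq_sqrt (by norm_num)
    -- Equivalent to `2√2 Δ < σ`: the hypothesis says exactly that the forbidden strip is nonempty,
    -- so a separating line `Re z = -g` fits inside.
    have hlt : √3 * Δ < √6 / 4 * σ := by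
      refine lt_of_pow_lt_pow_left₀ 2 (by positivity) ?_
      have h2 : (2 * √2 * Δ) ^ 2 < σ ^ 2 := pow_lt_pow_left₀ hgap (by positivity) two_ne_zero
      rw [mul_pow, mul_pow, Real.sq_sqrt (by norm_num)] at h2
      rw [mul_pow, mul_pow, div_pow, h3, h6]
      linarith
    obtain ⟨g, hg1, hg2⟩ := exists_between hlt
    have hg : 0 < g := lt_of_le_of_lt (by positivity) hg1
    have hg1' : 3 * (lamMax - lamMin) ^ 2 ≤ g ^ 2 := by
      have := pow_le_pow_left₀ (by positivity) hg1.le 2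
      rwa [mul_pow, h3, hΔ] at this
    have hg2' : g ^ 2 < 3 / 8 * σ ^ 2 := by
      have := pow_lt_pow_left₀ hg2 hg.le two_ne_zero
      rw [mul_pow, div_pow, h6] at this
      linarith
    have hdich : ∀ ν ∈ LQR.closedLoopEigenvalues A B X,
        ν.re ≤ -(√6 / 4 * σ) ∨ -(√3 * Δ) < ν.re := fun ν hν => by
      obtain ⟨x, hx⟩ := heig ν hν
      by_contra! hc
      have h1 : 3 * (lamMax - lamMin) ^ 2 ≤ ν.re ^ 2 := by
        have := pow_le_pow_left₀ (by positivity) (le_neg_of_le_neg hc.2) 2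
        rwa [mul_pow, h3, hΔ, neg_sq] at this
      have h2 := LQR.le_re_sq_of_isQuadraticEigenvector hx (hneg ν hν) hlam' hσ h1
      have h4 := pow_lt_pow_left₀ (neg_lt.mp hc.1) (neg_nonneg.mpr (hneg ν hν).le) two_ne_zero
      rw [mul_pow, div_pow, h6, neg_sq] at h4
      linarith
    -- No eigenvalue lies in the strip, so membership in either box depends only on the side of the
    -- line `Re z = -g`.
    have hlarge : ∀ ν ∈ LQR.closedLoopEigenvalues A B X,
        (ν ∈ Set.Icc (-‖B‖) (-(√6 / 4 * σ)) ×ℂ Set.Icc lamMin lamMax ↔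
          ν ∈ {z : ℂ | z.re < -g}) := fun ν hν => by
      refine ⟨fun h => lt_of_le_of_lt h.1.2 (neg_lt_neg hg2), fun h => ?_⟩
      refine ⟨⟨(hbox ν hν).1, (hdich ν hν).resolve_right fun h' => ?_⟩, (hbox ν hν).2⟩
      have : ν.re < -g := h
      linarith
    have hsmall : ∀ ν ∈ LQR.closedLoopEigenvalues A B X,
        (ν ∈ Set.Ioo (-(√3 * Δ)) 0 ×ℂ Set.Icc lamMin lamMax ↔
          ν ∈ {z : ℂ | z.re < -g}ᶜ) := fun ν hν => by
      refine ⟨fun h h' => ?_, fun h => ?_⟩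
      · have h1 : ν.re < -g := h'
        have h2 : -(√3 * Δ) < ν.re := h.1.1
        linarith
      · refine ⟨⟨(hdich ν hν).resolve_left fun h' => h ?_, hneg ν hν⟩, (hbox ν hν).2⟩
        exact lt_of_le_of_lt h' (neg_lt_neg hg2)
    have hcount := LQR.numIn_closedLoopEigenvalues hA hv hX hlam' hg hg1' hg2'
    have hcard : (LQR.closedLoopEigenvalues A B X).card = n := by
      rw [LQR.closedLoopEigenvalues, ← (IsAlgClosed.splits _).natDegree_eq_card_roots,
        Matrix.charpoly_natDegree_eq_dim, Fintype.card_fin]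
    have hsum := LQR.numIn_add_numIn_compl (LQR.closedLoopEigenvalues A B X) {z : ℂ | z.re < -g}
    refine ⟨(LQR.numIn_congr hlarge).trans hcount, (LQR.numIn_congr hsmall).trans ?_,
      fun ν hν h => (hsmall ν hν).mpr fun h' => h ((hlarge ν hν).mpr h')⟩
    omega
  · subst hm1
    obtain ⟨x, hx⟩ := heig ν hν
    exact LQR.notMem_closedBall_radiusOne hx (hneg ν hν) k
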